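/- Let $N \ge 3$ and $p \in (0,2)$. Let $\Gamma$ be the star graph made of $N$ half-lines $\mathbb{R}^+=(0,\infty)$ joined at a common vertex $x=0$. Let $L^2(\Gamma)=\bigoplus_{j=1}^N L^2(\mathbb{R}^+)$ be the space of complex-valued vectors $\Psi=(\psi_1,\dots,\psi_N)$ with inner product $\langle V,W\rangle_{L^2(\Gamma)}=\sum_{j=1}^N\int_0^\infty v_j\overline{w_j}\,dx$, and let $$H^1_\Gamma=\Big\{\Psi\in\bigoplus_{j=1}^N H^1(\mathbb{R}^+):\ \psi_1(0)=\psi_2(0)=\dots=\psi_N(0)\Big\},$$ with the $H^1$ norm. For $\Psi\in H^1_\Gamma$ let $\Lambda(\Psi)=E(\Psi)+Q(\Psi)$, where $$E(\Psi)=\|\Psi'\|_{L^2(\Gamma)}^2-\|\Psi\|_{L^{2p+2}(\Gamma)}^{2p+2},\qquad Q(\Psi)=\|\Psi\|_{L^2(\Gamma)}^2 .$$ Let $\Phi(x)=\phi(x)(1,1,\dots,1)$ with $\phi(x)=\operatorname{sech}^{1/p}(px)$, and let $L^2_c=\{V\in L^2(\Gamma):\langle V,\Phi\rangle_{L^2(\Gamma)}=0\}$.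 Then $\Lambda$, as a real-valued function on the real normed space $H^1_\Gamma$, is twice Fréchet differentiable at $\Phi$. Write $\langle\Lambda''(\Phi)V,W\rangle$ for its second derivative at $\Phi$ in the directions $V,W$. The following hold. (i) $\langle\Lambda''(\Phi)V,V\rangle\ge 0$ for every $V\in H^1_\Gamma\cap L^2_c$. (ii) For $1\le j\le N-1$ let $e_j=(1,\dots,1,-j,0,\dots,0)\in\mathbb{R}^N$, with $j$ leading ones, and let $U^{(j)}(x)=\phi'(x)e_j$. Then $U^{(1)},\dots,U^{(N-1)}$ belong to $H^1_\Gamma\cap L^2_c$, they are pairwise orthogonal in $L^2(\Gamma)$, and their real linear span $X_c$ has real dimension $N-1$. For $V\in H^1_\Gamma\cap L^2_c$ one has $\langle\Lambda''(\Phi)V,V\rangle=0$ if and only if $V\in X_c$. (iii) Consequently, $V=0$ is a degenerate minimizer of $V\mapsto\langle\Lambda''(\Phi)V,V\rangle$ on $H^1_\Gamma\cap L^2_c$: it is a minimizer, and there is a nonzero $V\in H^1_\Gamma\cap L^2_c$ such that $\langle\Lambda''(\Phi)V,W\rangle=0$ for all $W\in H^1_\Gamma\cap L^2_c$. -/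

import Mathlib

open MeasureTheory Set Filter Topology

open scoped ContDiff ComplexConjugate ENNReal

noncomputable section

namespace StarGraph

/-- Lebesgue measure on an edge `ℝ⁺ = (0, ∞)`. -/
abbrev edgeMeasure : Measure ℝ := volume.restrict (Ioi (0 : ℝ))

/-- The complex Hilbert space `L²(ℝ⁺)`. -/
abbrev L2 : Type := Lp ℂ 2 edgeMeasure

/-- `g` is the weak derivative of `f` on the open half-line `(0, ∞)`. -/
def HasWeakDeriv (f g : ℝ → ℂ) : Prop :=
  ∀ η : ℝ → ℝ, ContDiff ℝ ∞ η → HasCompactSupport η → tsupport η ⊆ Ioi (0 : ℝ) →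
    ∫ x in Ioi (0 : ℝ), deriv η x • f x = - ∫ x in Ioi (0 : ℝ), η x • g x

/-- `f` has a representative that is continuous on `[0, ∞)` and takes the value `a` at `0`. -/
def HasTrace (f : ℝ → ℂ) (a : ℂ) : Prop :=
  ∃ u : ℝ → ℂ, ContinuousOn u (Ici (0 : ℝ)) ∧ f =ᵐ[edgeMeasure] u ∧ u 0 = a

theorem integrable_smul_test {η : ℝ → ℝ} (hη : Continuous η) (hc : HasCompactSupport η)
    (f : L2) : Integrable (fun x => η x • f x) edgeMeasure := by
  have hf : LocallyIntegrable (f : ℝ → ℂ) edgeMeasure :=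
    (Lp.memLp f).locallyIntegrable (by norm_num)
  exact hf.integrable_smul_left_of_hasCompactSupport hη hc

/-- The Sobolev space `H¹(ℝ⁺)`: pairs `(f, f')` in `L²(ℝ⁺) × L²(ℝ⁺)` where `f'` is the weak
derivative of `f`, with the norm `(‖f‖² + ‖f'‖²)^(1/2)`. -/
def H1 : Submodule ℂ (WithLp 2 (L2 × L2)) where
  carrier := {u | HasWeakDeriv u.fst u.snd}
  zero_mem' := by
    intro η h1 h2 h3
    have e : ∀ w : ℝ → ℝ, ∫ x in Ioi (0 : ℝ), w x • ((0 : L2) : ℝ → ℂ) x = 0 := by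
      intro w
      rw [integral_congr_ae (g := fun _ => (0 : ℂ)), integral_zero]
      filter_upwards [Lp.coeFn_zero ℂ 2 edgeMeasure] with x hx
      rw [hx, Pi.zero_apply, smul_zero]
    simp only [WithLp.zero_fst, WithLp.zero_snd]
    rw [e, e, neg_zero]
  add_mem' := by
    intro u v hu hv η h1 h2 h3
    have e : ∀ w : ℝ → ℝ, Continuous w → HasCompactSupport w → ∀ f g : L2,
        ∫ x in Ioi (0 : ℝ), w x • ((f + g : L2) : ℝ → ℂ) x =
          (∫ x in Ioi (0 : ℝ), w x • f x) + ∫ x in Ioi (0 : ℝ), w x • g x := by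
      intro w hw hwc f g
      rw [← integral_add (integrable_smul_test hw hwc f) (integrable_smul_test hw hwc g)]
      apply integral_congr_ae
      filter_upwards [Lp.coeFn_add f g] with x hx
      rw [hx, Pi.add_apply, smul_add]
    simp only [WithLp.add_fst, WithLp.add_snd]
    rw [e _ (h1.continuous_deriv (by simp)) h2.deriv, e _ h1.continuous h2,
      hu η h1 h2 h3, hv η h1 h2 h3]
    ring
  smul_mem' := by
    intro c u hu η h1 h2 h3
    have e : ∀ w : ℝ → ℝ, ∀ f : L2,
        ∫ x in Ioi (0 : ℝ), w x • ((c • f : L2) : ℝ → ℂ) x =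
          c * ∫ x in Ioi (0 : ℝ), w x • f x := by
      intro w f
      rw [← integral_const_mul]
      apply integral_congr_ae
      filter_upwards [Lp.coeFn_smul c f] with x hx
      simp only [hx, Pi.smul_apply, smul_eq_mul, Complex.real_smul]
      ring
    simp only [WithLp.smul_fst, WithLp.smul_snd]
    rw [e, e, hu η h1 h2 h3]
    ring

/-- `H¹(Γ)`, the Hilbert sum of `N` copies of `H¹(ℝ⁺)`. -/
abbrev H1Graph (N : ℕ) : Type := PiLp 2 (fun _ : Fin N => H1)

/-- The energy space `H¹_Γ`: elements of `H¹(Γ)` whose components have the same value at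
the vertex. -/
def H1Vertex (N : ℕ) : Submodule ℂ (H1Graph N) where
  carrier := {Ψ | ∃ a : ℂ, ∀ j, HasTrace (Ψ j).1.fst a}
  zero_mem' := ⟨0, fun j => ⟨0, continuousOn_const, Lp.coeFn_zero ℂ 2 edgeMeasure, rfl⟩⟩
  add_mem' := by
    rintro Ψ Θ ⟨a, ha⟩ ⟨b, hb⟩
    refine ⟨a + b, fun j => ?_⟩
    obtain ⟨u, hu, hfu, rfl⟩ := ha j
    obtain ⟨v, hv, hfv, rfl⟩ := hb j
    exact ⟨u + v, hu.add hv, (Lp.coeFn_add _ _).trans (hfu.add hfv), rfl⟩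
  smul_mem' := by
    rintro c Ψ ⟨a, ha⟩
    refine ⟨c * a, fun j => ?_⟩
    obtain ⟨u, hu, hfu, rfl⟩ := ha j
    exact ⟨c • u, hu.const_smul c, (Lp.coeFn_smul c _).trans (hfu.const_smul c), rfl⟩

/-- The component `ψ_j` of `Ψ`. -/
def comp {N : ℕ} (Ψ : H1Vertex N) (j : Fin N) : L2 := (Ψ.1 j).1.fst

/-- The weak derivative `ψ_j'` of the component `ψ_j` of `Ψ`. -/
def compDeriv {N : ℕ} (Ψ : H1Vertex N) (j : Fin N) : L2 := (Ψ.1 j).1.snd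

/-- The inner product `⟨V, W⟩ = ∑ j, ∫ v_j conj(w_j) dx` of `L²(Γ)`. -/
def l2Inner {N : ℕ} (V W : H1Vertex N) : ℂ := ∑ j, inner ℂ (comp W j) (comp V j)

/-- The energy `E(Ψ) = ‖Ψ'‖² - ‖Ψ‖_{2p+2}^{2p+2}`. -/
def energy {N : ℕ} (p : ℝ) (Ψ : H1Vertex N) : ℝ :=
  (∑ j, ∫ x in Ioi (0 : ℝ), ‖compDeriv Ψ j x‖ ^ 2) -
    ∑ j, ∫ x in Ioi (0 : ℝ), ‖comp Ψ j x‖ ^ (2 * p + 2)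

/-- The mass `Q(Ψ) = ‖Ψ‖²`. -/
def mass {N : ℕ} (Ψ : H1Vertex N) : ℝ := ∑ j, ∫ x in Ioi (0 : ℝ), ‖comp Ψ j x‖ ^ 2

/-- The action `Λ = E + Q`. -/
def action (N : ℕ) (p : ℝ) (Ψ : H1Vertex N) : ℝ := energy p Ψ + mass Ψ

/-- The soliton profile `φ(x) = sech^{1/p}(p x)`. -/
def soliton (p x : ℝ) : ℝ := (1 / Real.cosh (p * x)) ^ (1 / p)

theorem hasDerivAt_soliton {p : ℝ} (hp : 0 < p) (x : ℝ) :
    HasDerivAt (soliton p) (-(soliton p x * Real.tanh (p * x))) x := by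
  have hc : 0 < Real.cosh (p * x) := Real.cosh_pos _
  have h1 : HasDerivAt (fun y : ℝ => Real.cosh (p * y)) (Real.sinh (p * x) * p) x := by
    simpa using ((hasDerivAt_id x).const_mul p).cosh
  have h2 := (h1.inv hc.ne').rpow_const (p := 1 / p) (Or.inl (inv_ne_zero hc.ne'))
  have h3 : soliton p = fun y => (fun y : ℝ => Real.cosh (p * y))⁻¹ y ^ (1 / p) := by
    funext y; simp [soliton]
  rw [h3]
  convert h2 using 1
  simp only [Pi.inv_apply]
  rw [Real.rpow_sub_one (inv_ne_zero hc.ne'), Real.tanh_eq_sinh_div_cosh]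
  field_simp

theorem soliton_nonneg (p x : ℝ) : 0 ≤ soliton p x :=
  Real.rpow_nonneg (by have := Real.cosh_pos (p * x); positivity) _

theorem soliton_le {p : ℝ} (hp : 0 < p) (x : ℝ) :
    soliton p x ≤ 2 ^ (1 / p) * Real.exp (-x) := by
  have h : 1 / Real.cosh (p * x) ≤ 2 * Real.exp (-(p * x)) := by
    rw [div_le_iff₀ (Real.cosh_pos _), Real.cosh_eq, Real.exp_neg]
    have := Real.exp_pos (p * x)
    field_simp
    nlinarith
  calc soliton p x ≤ (2 * Real.exp (-(p * x))) ^ (1 / p) :=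
        Real.rpow_le_rpow (by have := Real.cosh_pos (p * x); positivity) h (by positivity)
    _ = _ := by
        rw [Real.mul_rpow (by norm_num) (Real.exp_pos _).le, ← Real.exp_mul]
        congr 2
        field_simp

theorem memLp_of_soliton_bound {p : ℝ} (hp : 0 < p) {f : ℝ → ℂ} (hf : Continuous f)
    (hb : ∀ x, ‖f x‖ ≤ soliton p x) : MemLp f 2 edgeMeasure := by
  rw [memLp_two_iff_integrable_sq_norm hf.aestronglyMeasurable]
  have hi : Integrable (fun x : ℝ => (2 ^ (1 / p)) ^ 2 * Real.exp (-2 * x)) edgeMeasure :=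
    (integrableOn_exp_mul_Ioi (a := -2) (by norm_num) 0).const_mul _
  refine hi.mono' (by fun_prop) (ae_of_all _ fun x => ?_)
  rw [Real.norm_of_nonneg (by positivity)]
  calc ‖f x‖ ^ 2 ≤ (2 ^ (1 / p) * Real.exp (-x)) ^ 2 := by
        gcongr
        exact (hb x).trans (soliton_le hp x)
    _ = _ := by
        rw [mul_pow, ← Real.exp_nat_mul]
        congr 2
        push_cast; ring

theorem continuous_soliton {p : ℝ} (hp : 0 < p) : Continuous (soliton p) :=
  continuous_iff_continuousAt.2 fun x => (hasDerivAt_soliton hp x).continuousAt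

theorem deriv_soliton {p : ℝ} (hp : 0 < p) :
    deriv (soliton p) = fun x => -(soliton p x * Real.tanh (p * x)) :=
  funext fun x => (hasDerivAt_soliton hp x).deriv

theorem continuous_deriv_soliton {p : ℝ} (hp : 0 < p) : Continuous (deriv (soliton p)) := by
  rw [deriv_soliton hp]
  have h := continuous_soliton hp
  have : Continuous Real.tanh := by
    have : Real.tanh = fun x => Real.sinh x / Real.cosh x :=
      funext Real.tanh_eq_sinh_div_cosh
    rw [this]
    exact Real.continuous_sinh.div Real.continuous_cosh fun x => (Real.cosh_pos x).ne'
  fun_prop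

theorem memLp_soliton {p : ℝ} (hp : 0 < p) :
    MemLp (fun x => (soliton p x : ℂ)) 2 edgeMeasure := by
  have h := continuous_soliton hp
  refine memLp_of_soliton_bound hp (by fun_prop) fun x => ?_
  simp [abs_of_nonneg (soliton_nonneg p x)]

theorem memLp_deriv_soliton {p : ℝ} (hp : 0 < p) :
    MemLp (fun x => ((deriv (soliton p) x : ℝ) : ℂ)) 2 edgeMeasure := by
  have h := continuous_deriv_soliton hp
  refine memLp_of_soliton_bound hp (by fun_prop) fun x => ?_
  have ht : |Real.tanh (p * x)| ≤ 1 := (Real.abs_tanh_lt_one _).le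
  have hs := soliton_nonneg p x
  rw [deriv_soliton hp, Complex.norm_real, Real.norm_eq_abs, abs_neg, abs_mul, abs_of_nonneg hs]
  nlinarith

/-- The pair `(φ, φ')` as an element of `H¹(ℝ⁺)`. -/
def solitonH1 (p : ℝ) (hp : 0 < p) : H1 :=
  ⟨WithLp.toLp 2 ((memLp_soliton hp).toLp _, (memLp_deriv_soliton hp).toLp _), by
    intro η h1 h2 h3
    have hη := h1.continuous
    have hη' : Continuous (deriv η) := h1.continuous_deriv (by simp)
    have hφ := continuous_soliton hp
    have hφ' := continuous_deriv_soliton hp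
    have z : ∀ x ∉ Ioi (0 : ℝ), η x = 0 := fun x hx => image_eq_zero_of_notMem_tsupport
      fun h => hx (h3 h)
    have z' : ∀ x ∉ Ioi (0 : ℝ), deriv η x = 0 := fun x hx => image_eq_zero_of_notMem_tsupport
      fun h => hx (h3 (tsupport_deriv_subset h))
    have a1 : ∫ x in Ioi (0 : ℝ), deriv η x • ((memLp_soliton hp).toLp _ : ℝ → ℂ) x =
        ∫ x, (soliton p x : ℂ) * ((deriv η x : ℝ) : ℂ) := by
      rw [← setIntegral_eq_integral_of_forall_compl_eq_zero (μ := volume) (s := Ioi (0 : ℝ))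
        (f := fun x => (soliton p x : ℂ) * ((deriv η x : ℝ) : ℂ))
        (fun x hx => by simp [z' x hx])]
      apply integral_congr_ae
      filter_upwards [(memLp_soliton hp).coeFn_toLp] with x hx
      rw [hx, Complex.real_smul, mul_comm]
    have a2 : ∫ x in Ioi (0 : ℝ), η x • ((memLp_deriv_soliton hp).toLp _ : ℝ → ℂ) x =
        ∫ x, ((deriv (soliton p) x : ℝ) : ℂ) * (η x : ℂ) := by
      rw [← setIntegral_eq_integral_of_forall_compl_eq_zero (μ := volume) (s := Ioi (0 : ℝ))
        (f := fun x => ((deriv (soliton p) x : ℝ) : ℂ) * (η x : ℂ))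
        (fun x hx => by simp [z x hx])]
      apply integral_congr_ae
      filter_upwards [(memLp_deriv_soliton hp).coeFn_toLp] with x hx
      rw [hx, Complex.real_smul, mul_comm]
    change ∫ x in Ioi (0 : ℝ), deriv η x • ((memLp_soliton hp).toLp _ : ℝ → ℂ) x =
      -∫ x in Ioi (0 : ℝ), η x • ((memLp_deriv_soliton hp).toLp _ : ℝ → ℂ) x
    rw [a1, a2]
    have c : ∀ w v : ℝ → ℝ, Continuous w → Continuous v → HasCompactSupport v →
        Integrable (fun x => (w x : ℂ) * (v x : ℂ)) := by
      intro w v hw hv hvc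
      apply Continuous.integrable_of_hasCompactSupport (by fun_prop)
      exact HasCompactSupport.mul_left (hvc.comp_left (g := fun t : ℝ => (t : ℂ)) (by simp))
    refine integral_mul_deriv_eq_deriv_mul_of_integrable
      (u := fun x => (soliton p x : ℂ)) (v := fun x => (η x : ℂ))
      (fun x _ => ?_) (fun x _ => ?_) (c _ _ hφ hη' h2.deriv) (c _ _ hφ' hη h2) (c _ _ hφ hη h2)
    · exact ((hasDerivAt_soliton hp x).differentiableAt.hasDerivAt).ofReal_comp
    · exact ((h1.differentiable (by simp) x).hasDerivAt).ofReal_comp⟩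

/-- The half-soliton state `Φ = φ (1, …, 1)` as an element of `H¹_Γ`. -/
def halfSoliton (N : ℕ) (p : ℝ) (hp : 0 < p) : H1Vertex N :=
  ⟨WithLp.toLp 2 fun _ => solitonH1 p hp, (soliton p 0 : ℂ), fun _ =>
    ⟨fun x => (soliton p x : ℂ),
      (Complex.continuous_ofReal.comp (continuous_soliton hp)).continuousOn,
      (memLp_soliton hp).coeFn_toLp, rfl⟩⟩

/-- The constrained space `H¹_Γ ∩ L²_c = {V ∈ H¹_Γ : ⟨V, Φ⟩ = 0}`. -/
def constrained (N : ℕ) (p : ℝ) (hp : 0 < p) : Submodule ℂ (H1Vertex N) where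
  carrier := {V | l2Inner V (halfSoliton N p hp) = 0}
  zero_mem' := by simp [l2Inner, comp]
  add_mem' := by
    intro V W hV hW
    have : l2Inner (V + W) (halfSoliton N p hp) =
        l2Inner V (halfSoliton N p hp) + l2Inner W (halfSoliton N p hp) := by
      simp [l2Inner, comp, inner_add_right, Finset.sum_add_distrib]
    rw [mem_ofPred_eq, this, hV, hW, add_zero]
  smul_mem' := by
    intro c V hV
    have : l2Inner (c • V) (halfSoliton N p hp) = c * l2Inner V (halfSoliton N p hp) := by
      simp [l2Inner, comp, inner_smul_right, Finset.mul_sum]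
    rw [mem_ofPred_eq, this, hV, mul_zero]

/-- The second variation `Λ''(Φ)` in `H¹_Γ`: the second Fréchet derivative of `Λ` at `Φ`, where
`H¹_Γ` is regarded as a real normed space. `hessian N p hp V V` is the quadratic form
`⟨Λ''(Φ) V, V⟩`. -/
def hessian (N : ℕ) (p : ℝ) (hp : 0 < p) : H1Vertex N →L[ℝ] H1Vertex N →L[ℝ] ℝ :=
  fderiv ℝ (fderiv ℝ (action N p)) (halfSoliton N p hp)

/-- The vectors `(1, -1, 0, …, 0)`, `(1, 1, -2, 0, …, 0)`, …, `(1, …, 1, -(N-1))` of `ℝ^N`. -/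
def dirVec (N : ℕ) (j : Fin (N - 1)) (k : Fin N) : ℝ :=
  if k.val ≤ j.val then 1 else if k.val = j.val + 1 then -((j.val : ℝ) + 1) else 0

end StarGraph

end

/-! The second variation at $\Phi$ decouples into real and imaginary parts: it is twice the sum over
the edges of $\int v'^2+V_+v^2$ and $\int w'^2+V_-w^2$, where
$V_+=1-(2p+1)(p+1)\,\mathrm{sech}^2(px)$ and $V_-=1-(p+1)\,\mathrm{sech}^2(px)$. Each form is
treated by factorization. If $\psi$ has no zero on $(0,\infty)$ and $\psi''=V\psi$, then
$k=\psi'/\psi$ satisfies $k'+k^2=V$, and $\int v'^2+Vv^2=\int(v'-kv)^2$ as soon as the boundary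
terms $kv^2$ vanish. Equality to zero forces $v$ to be a multiple of $\psi$
(`IsRiccati.eq_const_mul_of_schrodingerForm_eq_zero`).

For $V_-$ take $\psi=\varphi$. Here $k(0)=0$, so no vertex condition is needed. Null vectors are
multiples of $\varphi$ on each edge, equal by continuity at the vertex, and killed by the
constraint.

For $V_+$ take $\psi=\varphi'$. Since $\varphi'(0)=0$, $k$ has a pole at the vertex and the
factorization requires $v(0)=0$. A common vertex value $a$ is removed by subtracting $b\chi$ on
every edge, where $\chi=\frac{d}{d\omega}\big|_{\omega=1}\omega^{1/(2p)}\varphi(\sqrt\omega x)$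
satisfies $-\chi''+V_+\chi=-\varphi$, $\chi'(0)=0$, $\chi(0)=1/(2p)$, and $b=2pa$. Under the
constraint the cross terms sum to zero, leaving the gain $Nb^2\langle\chi,\varphi\rangle$
(`sum_realForm_eq`), and $\langle\chi,\varphi\rangle=(\frac1{2p}-\frac14)\|\varphi\|^2>0$ because
$p<2$. So null vectors have $a=0$ and equal $c_j\varphi'$ on edge $j$; since
$\int\varphi'\varphi=-\frac12$, the constraint reads $\sum c_j=0$, a space of dimension $N-1$
spanned by the $e_j$.

Fréchet differentiability rests on the embedding of $H^1$ in $L^\infty$, which makes superposition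
with a $C^1$ field differentiable from $H^1_\Gamma$ to $L^2$ (`semilinear_calculus`). -/

noncomputable section

namespace StarGraph

/-! ### Absolutely continuous functions and real $H^1$ functions on the half-line. -/

/-- `v` is absolutely continuous between `a` and `b`, with almost everywhere derivative `g`. -/
structure HasACDeriv (v g : ℝ → ℝ) (a b : ℝ) : Prop where
  ac : AbsolutelyContinuousOnInterval v a b
  hasDerivAt : ∀ᵐ x, x ∈ uIcc a b → HasDerivAt v (g x) x

namespace HasACDeriv

variable {v w g h : ℝ → ℝ} {a b c d : ℝ}

theorem mono (hv : HasACDeriv v g a b) (hs : uIcc c d ⊆ uIcc a b) : HasACDeriv v g c d :=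
  ⟨hv.ac.mono hs, by filter_upwards [hv.hasDerivAt] with x hx h using hx (hs h)⟩

theorem add (hv : HasACDeriv v g a b) (hw : HasACDeriv w h a b) :
    HasACDeriv (fun x => v x + w x) (fun x => g x + h x) a b :=
  ⟨hv.ac.add hw.ac, by
    filter_upwards [hv.hasDerivAt, hw.hasDerivAt] with x hx hy hm using (hx hm).add (hy hm)⟩

theorem const_mul (t : ℝ) (hv : HasACDeriv v g a b) :
    HasACDeriv (fun x => t * v x) (fun x => t * g x) a b :=
  ⟨hv.ac.const_mul t, by
    filter_upwards [hv.hasDerivAt] with x hx hm using (hx hm).const_mul t⟩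

theorem mul (hv : HasACDeriv v g a b) (hw : HasACDeriv w h a b) :
    HasACDeriv (fun x => v x * w x) (fun x => g x * w x + v x * h x) a b :=
  ⟨hv.ac.mul hw.ac, by
    filter_upwards [hv.hasDerivAt, hw.hasDerivAt] with x hx hy hm using (hx hm).mul (hy hm)⟩

theorem deriv_ae_eq (hv : HasACDeriv v g a b) :
    ∀ᵐ x, x ∈ uIoc a b → deriv v x = g x := by
  filter_upwards [hv.hasDerivAt] with x hx hm using (hx (uIoc_subset_uIcc hm)).deriv

theorem intervalIntegrable (hv : HasACDeriv v g a b) : IntervalIntegrable g volume a b := by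
  refine hv.ac.intervalIntegrable_deriv.congr_ae ?_
  rw [Filter.EventuallyEq, ae_restrict_iff' measurableSet_uIoc]
  exact hv.deriv_ae_eq

theorem integral_eq (hv : HasACDeriv v g a b) : ∫ x in a..b, g x = v b - v a := by
  rw [← hv.ac.integral_deriv_eq_sub]
  refine intervalIntegral.integral_congr_ae ?_
  filter_upwards [hv.deriv_ae_eq] with x hx hm using (hx hm).symm

theorem of_hasDerivAt (hv : ∀ x ∈ uIcc a b, HasDerivAt v (g x) x) (hg : ContinuousOn g (uIcc a b)) :
    HasACDeriv v g a b := by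
  refine ⟨?_, ae_of_all _ hv⟩
  obtain ⟨C, hC⟩ := isCompact_uIcc.exists_bound_of_continuousOn hg
  have : LipschitzOnWith C.toNNReal v (uIcc a b) := by
    refine (convex_uIcc a b).lipschitzOnWith_of_nnnorm_hasDerivWithin_le
      (fun x hx => (hv x hx).hasDerivWithinAt) fun x hx => ?_
    rw [← NNReal.coe_le_coe]
    exact (hC x hx).trans (Real.le_coe_toNNReal C)
  exact this.absolutelyContinuousOnInterval

theorem of_integral (hg : IntervalIntegrable g volume a b) (t : ℝ) :
    HasACDeriv (fun x => t + ∫ y in a..x, g y) g a b := by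
  have h0 : HasACDeriv (fun _ => t) (fun _ => 0) a b :=
    of_hasDerivAt (fun x _ => hasDerivAt_const x t) continuousOn_const
  have h1 : HasACDeriv (fun x => ∫ y in a..x, g y) g a b :=
    ⟨hg.absolutelyContinuousOnInterval_intervalIntegral (by simp), by
      filter_upwards [hg.ae_hasDerivAt_integral] with x hx hm using hx hm a (by simp)⟩
  simpa using h0.add h1

end HasACDeriv

/-- `v` is a real function in `H¹(ℝ⁺)`, absolutely continuous up to the vertex, and `g` is its
derivative. -/
structure IsH1 (v g : ℝ → ℝ) : Prop where
  memLp : MemLp v 2 edgeMeasure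
  memLp_deriv : MemLp g 2 edgeMeasure
  hasACDeriv : ∀ b, 0 ≤ b → HasACDeriv v g 0 b

namespace IsH1

variable {v w g h : ℝ → ℝ}

theorem hasACDeriv' (hv : IsH1 v g) {a b : ℝ} (ha : 0 ≤ a) (hb : 0 ≤ b) : HasACDeriv v g a b := by
  refine (hv.hasACDeriv (max a b) (le_max_of_le_left ha)).mono ?_
  rw [uIcc_of_le (le_max_of_le_left ha)]
  intro x hx
  exact ⟨(le_min ha hb).trans hx.1, hx.2⟩

theorem add (hv : IsH1 v g) (hw : IsH1 w h) :
    IsH1 (fun x => v x + w x) (fun x => g x + h x) :=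
  ⟨hv.memLp.add hw.memLp, hv.memLp_deriv.add hw.memLp_deriv,
    fun b hb => (hv.hasACDeriv b hb).add (hw.hasACDeriv b hb)⟩

theorem const_mul (t : ℝ) (hv : IsH1 v g) : IsH1 (fun x => t * v x) (fun x => t * g x) :=
  ⟨hv.memLp.const_mul t, hv.memLp_deriv.const_mul t,
    fun b hb => (hv.hasACDeriv b hb).const_mul t⟩

theorem continuousOn (hv : IsH1 v g) : ContinuousOn v (Ici 0) := by
  intro x hx
  have hx' : (0 : ℝ) ≤ x := hx
  have h := (hv.hasACDeriv (x + 1) (by linarith)).ac.continuousOn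
  rw [uIcc_of_le (by linarith)] at h
  have hm : Icc 0 (x + 1) ∈ 𝓝[Ici 0] x := by
    rw [← Ici_inter_Iic]
    exact inter_mem_nhdsWithin _ (Iic_mem_nhds (by linarith))
  exact (h x ⟨hx', by linarith⟩).mono_of_mem_nhdsWithin hm

theorem integral_mul_deriv (hv : IsH1 v g) {x y : ℝ} (hx : 0 ≤ x) (hy : 0 ≤ y) :
    ∫ t in x..y, 2 * (v t * g t) = v y ^ 2 - v x ^ 2 := by
  rw [pow_two, pow_two, ← ((hv.hasACDeriv' hx hy).mul (hv.hasACDeriv' hx hy)).integral_eq]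
  congr 1; ext t; ring

theorem integrableOn_mul (hv : MemLp v 2 edgeMeasure) (hg : MemLp g 2 edgeMeasure) :
    IntegrableOn (fun t => v t * g t) (Ioi 0) :=
  hv.integrable_mul hg

theorem integrableOn_sq (hv : MemLp v 2 edgeMeasure) :
    IntegrableOn (fun t => v t ^ 2) (Ioi 0) := hv.integrable_sq

/-- The derivative $2vv'$ of $v^2$ is integrable, so $v^2$ has a limit; integrability of $v^2$ makes
that limit zero. -/
theorem tendsto_sq_atTop (hv : IsH1 v g) : Tendsto (fun x => v x ^ 2) atTop (𝓝 0) := by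
  have hi := (integrableOn_mul hv.memLp hv.memLp_deriv).const_mul 2
  have h1 := intervalIntegral_tendsto_integral_Ioi 0 hi tendsto_id
  have h2 : Tendsto (fun x => v x ^ 2) atTop
      (𝓝 (v 0 ^ 2 + ∫ t in Ioi 0, 2 * (v t * g t))) := by
    refine (h1.const_add (v 0 ^ 2)).congr' ?_
    filter_upwards [eventually_ge_atTop 0] with x hx
    rw [id, hv.integral_mul_deriv le_rfl hx]
    ring
  have h3 : IntegrableAtFilter (fun t => v t ^ 2) atTop :=
    ⟨Ioi 0, Ioi_mem_atTop 0, integrableOn_sq hv.memLp⟩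
  rwa [h3.eq_zero_of_tendsto ?_ h2] at h2
  intro s hs
  obtain ⟨t, ht⟩ := mem_atTop_sets.1 hs
  rw [← top_le_iff, ← Real.volume_Ici (a := t)]
  exact measure_mono ht

/-- Sobolev embedding with constant $1$: $v(x)^2=-\int_x^\infty 2vv'$, and $-2vv'\le v^2+v'^2$. -/
theorem sq_le (hv : IsH1 v g) {x : ℝ} (hx : 0 ≤ x) :
    v x ^ 2 ≤ (∫ t in Ioi 0, v t ^ 2) + ∫ t in Ioi 0, g t ^ 2 := by
  have hV := integrableOn_sq hv.memLp
  have hG := integrableOn_sq hv.memLp_deriv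
  rw [← integral_add hV hG]
  have hb : ∀ᶠ y in atTop, v x ^ 2 - v y ^ 2 ≤ ∫ t in Ioi 0, (v t ^ 2 + g t ^ 2) := by
    filter_upwards [eventually_ge_atTop x] with y hy
    have hsub : Ioc x y ⊆ Ioi 0 := fun t ht => lt_of_le_of_lt hx ht.1
    have e : v x ^ 2 - v y ^ 2 = ∫ t in Ioc x y, -(2 * (v t * g t)) := by
      rw [integral_neg, ← intervalIntegral.integral_of_le hy,
        hv.integral_mul_deriv hx (hx.trans hy)]
      ring
    rw [e]
    calc _ ≤ ∫ t in Ioc x y, (v t ^ 2 + g t ^ 2) := by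
          refine integral_mono
            (IntegrableOn.mono_set
              ((integrableOn_mul hv.memLp hv.memLp_deriv).const_mul 2).neg hsub)
            ((hV.add hG).mono_set hsub) fun t => ?_
          simp only
          nlinarith [sq_nonneg (v t + g t)]
      _ ≤ _ := setIntegral_mono_set (hV.add hG)
          (ae_of_all _ fun t => by simp only [Pi.zero_apply]; positivity) hsub.eventuallyLE
  have ht : Tendsto (fun y => v x ^ 2 - v y ^ 2) atTop (𝓝 (v x ^ 2 - 0)) :=
    hv.tendsto_sq_atTop.const_sub _
  rw [sub_zero] at ht
  exact le_of_tendsto ht hb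

theorem of_hasDerivAt (hv : ∀ x, HasDerivAt v (g x) x) (hg : Continuous g)
    (h2 : MemLp v 2 edgeMeasure) (h2' : MemLp g 2 edgeMeasure) : IsH1 v g :=
  ⟨h2, h2', fun _ _ => .of_hasDerivAt (fun x _ => hv x) hg.continuousOn⟩

end IsH1

/-! ### Weak derivatives and absolutely continuous representatives. -/

/-- A continuous compactly supported function on `(0, ∞)` is supported in some `[a, b]` with
`0 < a`. -/
theorem exists_tsupport_subset_Icc {η : ℝ → ℝ} (hc : HasCompactSupport η)
    (hs : tsupport η ⊆ Ioi (0 : ℝ)) : ∃ a b : ℝ, 0 < a ∧ a ≤ b ∧ tsupport η ⊆ Icc a b := by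
  rcases (tsupport η).eq_empty_or_nonempty with h | h
  · exact ⟨1, 1, one_pos, le_rfl, by simp [h]⟩
  · have hK : IsCompact (tsupport η) := hc
    obtain ⟨a, ha, ha'⟩ := hK.exists_isLeast h
    obtain ⟨b, hb, hb'⟩ := hK.exists_isGreatest h
    exact ⟨a, b, hs ha, ha' hb, fun x hx => ⟨ha' hx, hb' hx⟩⟩

/-- A test function on `(0, ∞)` with vanishing integral is the derivative of a test function. -/
theorem exists_test_primitive {η : ℝ → ℝ} (h1 : ContDiff ℝ ∞ η) (h2 : HasCompactSupport η)
    (h3 : tsupport η ⊆ Ioi (0 : ℝ)) (h0 : ∫ x, η x = 0) :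
    ∃ ζ : ℝ → ℝ, ContDiff ℝ ∞ ζ ∧ HasCompactSupport ζ ∧ tsupport ζ ⊆ Ioi (0 : ℝ) ∧
      deriv ζ = η := by
  obtain ⟨a, b, ha, hab, hs⟩ := exists_tsupport_subset_Icc h2 h3
  have hz : ∀ x, x ∉ Icc a b → η x = 0 := fun x hx =>
    image_eq_zero_of_notMem_tsupport fun h => hx (hs h)
  have hd : ∀ x, HasDerivAt (fun y => ∫ t in (0 : ℝ)..y, η t) (η x) x := fun x =>
    intervalIntegral.integral_hasDerivAt_right (h1.continuous.intervalIntegrable _ _)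
      (h1.continuous.stronglyMeasurableAtFilter _ _) h1.continuous.continuousAt
  have hde : deriv (fun y => ∫ t in (0 : ℝ)..y, η t) = η := funext fun x => (hd x).deriv
  have hi : Integrable η := h1.continuous.integrable_of_hasCompactSupport h2
  -- To the left of $a$ the integrand vanishes; to the right of $b$ the primitive equals the full
  -- integral, which is zero.
  have hzero : ∀ x, x ∉ Icc a b → ∫ t in (0 : ℝ)..x, η t = 0 := by
    intro x hx
    rcases lt_or_ge x a with hxa | hxa
    · rw [intervalIntegral.integral_congr (g := fun _ => (0 : ℝ)), intervalIntegral.integral_zero]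
      intro t ht
      refine hz t fun h => ?_
      have := ht.2
      have h' : max 0 x < a := max_lt ha hxa
      exact absurd (this.trans_lt h') (not_lt.2 h.1)
    · have hxb : b < x := by
        by_contra hcon
        exact hx ⟨hxa, not_lt.1 hcon⟩
      rw [intervalIntegral.integral_eq_integral_of_support_subset, h0]
      intro t ht
      have : t ∈ Icc a b := by
        by_contra hcon
        exact ht (hz t hcon)
      exact ⟨ha.trans_le this.1, this.2.trans hxb.le⟩
  have hsup : tsupport (fun y => ∫ t in (0 : ℝ)..y, η t) ⊆ Icc a b :=
    closure_minimal (fun x hx => by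
      by_contra hcon
      exact hx (hzero x hcon)) isClosed_Icc
  refine ⟨fun y => ∫ t in (0 : ℝ)..y, η t, ?_, ?_, ?_, hde⟩
  · rw [contDiff_infty_iff_deriv, hde]
    exact ⟨fun x => (hd x).differentiableAt, h1⟩
  · exact isCompact_Icc.of_isClosed_subset (isClosed_tsupport _) hsup
  · exact fun x hx => ha.trans_le (hsup hx).1

/-- A locally integrable function on `(0, ∞)` with vanishing weak derivative is constant. -/
theorem ae_eq_const_of_weakDeriv_zero {d : ℝ → ℝ} (hd : LocallyIntegrableOn d (Ioi 0))
    (hi : ∀ η : ℝ → ℝ, Continuous η → HasCompactSupport η → tsupport η ⊆ Ioi (0 : ℝ) →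
      Integrable fun x => η x * d x)
    (h : ∀ η : ℝ → ℝ, ContDiff ℝ ∞ η → HasCompactSupport η → tsupport η ⊆ Ioi (0 : ℝ) →
      ∫ x, deriv η x * d x = 0) :
    ∃ c, ∀ᵐ x, x ∈ Ioi (0 : ℝ) → d x = c := by
  -- The normalized bump is supported in $[1,3]\subset(0,\infty)$ and has integral $1$; the constant
  -- will be the pairing of `d` with it.
  let B : ContDiffBump (2 : ℝ) := ⟨1 / 2, 1, by norm_num, by norm_num⟩
  set η₀ : ℝ → ℝ := B.normed volume with hη₀
  have k1 : ContDiff ℝ ∞ η₀ := B.contDiff_normed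
  have k2 : HasCompactSupport η₀ := B.hasCompactSupport_normed
  have k3 : tsupport η₀ ⊆ Ioi (0 : ℝ) := by
    rw [hη₀, B.tsupport_normed_eq]
    intro x hx
    rw [Metric.mem_closedBall, Real.dist_eq] at hx
    have hx' : |x - 2| ≤ 1 := hx
    have := (abs_le.1 hx').1
    exact mem_Ioi.2 (by linarith)
  have k4 : ∫ x, η₀ x = 1 := B.integral_normed
  refine ⟨∫ x, η₀ x * d x, ?_⟩
  set c := ∫ x, η₀ x * d x with hc
  have key := isOpen_Ioi.ae_eq_zero_of_integral_contDiff_smul_eq_zero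
    (f := fun x => d x - c) (hd.sub ((locallyIntegrable_const c).locallyIntegrableOn _)) ?_
  · filter_upwards [key] with x hx hm using sub_eq_zero.1 (hx hm)
  intro η h1 h2 h3
  have hηi : Integrable η := h1.continuous.integrable_of_hasCompactSupport h2
  have hη₀i : Integrable η₀ := k1.continuous.integrable_of_hasCompactSupport k2
  set m := ∫ x, η x with hm
  have hsup : tsupport (fun x => η x - m * η₀ x) ⊆ tsupport η ∪ tsupport η₀ := by
    refine closure_minimal (fun x hx => ?_) ((isClosed_tsupport _).union (isClosed_tsupport _))
    by_contra hcon
    rw [mem_union, not_or] at hcon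
    exact hx (by simp [image_eq_zero_of_notMem_tsupport hcon.1,
      image_eq_zero_of_notMem_tsupport hcon.2])
  -- Removing the multiple $m\eta_0$ leaves mean zero, hence the derivative of a test function,
  -- against which `d` integrates to zero.
  obtain ⟨ζ, z1, z2, z3, z4⟩ := exists_test_primitive (η := fun x => η x - m * η₀ x)
    (h1.sub (contDiff_const.mul k1))
    ((h2.isCompact.union k2.isCompact).of_isClosed_subset (isClosed_tsupport _) hsup)
    (hsup.trans (union_subset h3 k3))
    (by rw [integral_sub hηi (hη₀i.const_mul m), integral_const_mul, k4, mul_one, sub_self])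
  have hz := h ζ z1 z2 z3
  rw [z4] at hz
  have e1 : ∫ x, (η x - m * η₀ x) * d x = (∫ x, η x * d x) - m * c := by
    rw [hc, ← integral_const_mul, ← integral_sub (hi η h1.continuous h2 h3)
      ((hi η₀ k1.continuous k2 k3).const_mul m)]
    congr 1; ext x; ring
  rw [e1] at hz
  simp only [smul_eq_mul, mul_sub]
  rw [integral_sub (hi η h1.continuous h2 h3) (hηi.mul_const c), integral_mul_const, hz]

/-- A square integrable function whose weak derivative is square integrable is, up to a constant,
the primitive of its weak derivative. -/
theorem exists_isH1_of_weakDeriv {f g : ℝ → ℝ} (hf : MemLp f 2 edgeMeasure)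
    (hg : MemLp g 2 edgeMeasure)
    (h : ∀ η : ℝ → ℝ, ContDiff ℝ ∞ η → HasCompactSupport η → tsupport η ⊆ Ioi (0 : ℝ) →
      ∫ x in Ioi (0 : ℝ), deriv η x * f x = - ∫ x in Ioi (0 : ℝ), η x * g x) :
    ∃ v, IsH1 v g ∧ f =ᵐ[edgeMeasure] v := by
  -- Extension by zero is locally integrable on the whole line, so it has a primitive starting at
  -- the vertex.
  set g' : ℝ → ℝ := (Ioi (0 : ℝ)).indicator g with hg'
  have hgL : LocallyIntegrable g' :=
    ((memLp_indicator_iff_restrict measurableSet_Ioi).2 hg).locallyIntegrable (by norm_num)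
  set f' : ℝ → ℝ := (Ioi (0 : ℝ)).indicator f with hf'
  have hfL : LocallyIntegrable f' :=
    ((memLp_indicator_iff_restrict measurableSet_Ioi).2 hf).locallyIntegrable (by norm_num)
  have hgi : ∀ a b, IntervalIntegrable g' volume a b := fun a b =>
    (hgL.integrableOn_isCompact isCompact_uIcc).intervalIntegrable
  set P : ℝ → ℝ := fun x => ∫ y in (0 : ℝ)..x, g' y with hP
  have hPc : Continuous P := intervalIntegral.continuous_primitive hgi 0
  have hPac : ∀ t b, HasACDeriv (fun x => t + P x) g' 0 b := fun t b =>
    .of_integral (hgi 0 b) t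
  have hdL : LocallyIntegrable fun x => f' x - P x := hfL.sub hPc.locallyIntegrable
  have hηf : ∀ {η : ℝ → ℝ}, Continuous η → HasCompactSupport η → Integrable fun x => η x * f' x :=
    fun h1 h2 => hfL.integrable_smul_left_of_hasCompactSupport h1 h2
  have hηP : ∀ {η : ℝ → ℝ}, Continuous η → HasCompactSupport η → Integrable fun x => η x * P x :=
    fun h1 h2 => hPc.locallyIntegrable.integrable_smul_left_of_hasCompactSupport h1 h2
  obtain ⟨c, hc⟩ := ae_eq_const_of_weakDeriv_zero (d := fun x => f' x - P x)
    (hdL.locallyIntegrableOn _)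
    (fun η h1 h2 _ => by simp only [mul_sub]; exact (hηf h1 h2).sub (hηP h1 h2)) (by
      intro η h1 h2 h3
      have hη' : Continuous (deriv η) := h1.continuous_deriv (by simp)
      simp only [mul_sub]
      rw [integral_sub (hηf hη' h2.deriv) (hηP hη' h2.deriv), sub_eq_zero]
      obtain ⟨a, b, ha, hab, hs⟩ := exists_tsupport_subset_Icc h2 h3
      have hz : ∀ x, x ∉ Icc a b → η x = 0 := fun x hx =>
        image_eq_zero_of_notMem_tsupport fun h => hx (hs h)
      have hz' : ∀ x, x ∉ Icc a b → deriv η x = 0 := fun x hx =>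
        image_eq_zero_of_notMem_tsupport fun h => hx (hs (tsupport_deriv_subset h))
      have e1 : ∫ x, deriv η x * f' x = ∫ x in Ioi (0 : ℝ), deriv η x * f x := by
        rw [← integral_indicator measurableSet_Ioi]
        congr 1; ext x
        by_cases hx : x ∈ Ioi (0 : ℝ) <;> simp [hf', hx]
      have e2 : ∫ x in Ioi (0 : ℝ), η x * g x = ∫ x, η x * g' x := by
        rw [← integral_indicator measurableSet_Ioi]
        congr 1; ext x
        by_cases hx : x ∈ Ioi (0 : ℝ) <;> simp [hg', hx]
      -- The interval ends at $b+1$ so that both endpoints lie outside $[a,b]$ and the boundary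
      -- terms of $\eta P$ vanish.
      have e3 : ∫ x in (0 : ℝ)..(b + 1), (deriv η x * P x + η x * g' x) = 0 := by
        have hη : HasACDeriv η (deriv η) 0 (b + 1) := .of_hasDerivAt
          (fun x _ => (h1.differentiable (by simp) x).hasDerivAt) hη'.continuousOn
        have := (hη.mul (hPac 0 (b + 1))).integral_eq
        simp only [zero_add] at this
        rw [this, hz (b + 1) (fun h => by linarith [h.2]), hz 0 (fun h => by linarith [h.1])]
        ring
      have hηg : Integrable fun x => η x * g' x :=
        hgL.integrable_smul_left_of_hasCompactSupport h1.continuous h2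
      have hI' : Icc a b ⊆ Ioc 0 (b + 1) := fun x hx => ⟨ha.trans_le hx.1, by linarith [hx.2]⟩
      rw [intervalIntegral.integral_eq_integral_of_support_subset, integral_add
        (hηP hη' h2.deriv) hηg] at e3
      · rw [e1, h η h1 h2 h3, e2]
        linarith
      · intro x hx
        by_contra hcon
        have : x ∉ Icc a b := fun h => hcon (hI' h)
        exact hx (by simp [hz x this, hz' x this]))
  have hae : f =ᵐ[edgeMeasure] fun x => c + P x := by
    rw [Filter.EventuallyEq, ae_restrict_iff' measurableSet_Ioi]
    filter_upwards [hc] with x hx hm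
    have := hx hm
    simp only [hf', indicator_of_mem hm] at this
    linarith
  refine ⟨fun x => c + P x, ⟨hf.ae_eq hae, hg, fun b hb => ⟨(hPac c b).ac, ?_⟩⟩, hae⟩
  -- The extension by zero need not agree with `g` at the vertex, so that single point is discarded.
  have h0 : ∀ᵐ x : ℝ, x ≠ 0 := by simp [ae_iff, measure_singleton]
  filter_upwards [(hPac c b).hasDerivAt, h0] with x hx hx0 hm
  have : x ∈ Ioi (0 : ℝ) := by
    rw [uIcc_of_le hb] at hm
    exact lt_of_le_of_ne hm.1 hx0.symm
  simpa only [hg', indicator_of_mem this] using hx hm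

/-! ### Factorization of Schrödinger forms by Riccati solutions. -/

/-- The quadratic form `∫ v'² + V v²` of the Schrödinger operator `-∂² + V` on the half-line. -/
def schrodingerForm (V v g : ℝ → ℝ) : ℝ := ∫ x in Ioi (0 : ℝ), (g x ^ 2 + V x * v x ^ 2)

/-- `k` solves the Riccati equation `k' + k² = V` on `(0, ∞)` and is bounded at infinity. -/
structure IsRiccati (V k : ℝ → ℝ) : Prop where
  hasDerivAt : ∀ x, 0 < x → HasDerivAt k (V x - k x ^ 2) x
  bounded : ∃ B, ∀ x, 1 ≤ x → |k x| ≤ B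

theorem IsH1.integrableOn_potential_mul {v g V : ℝ → ℝ} (hv : MemLp v 2 edgeMeasure)
    (hg : MemLp g 2 edgeMeasure) (hV : Continuous V) {M : ℝ} (hM : ∀ x, |V x| ≤ M) :
    IntegrableOn (fun x => V x * (v x * g x)) (Ioi 0) :=
  (integrableOn_mul hv hg).bdd_mul (c := M) hV.aestronglyMeasurable (ae_of_all _ hM)

theorem IsH1.integrableOn_form {v g V : ℝ → ℝ} (hv : IsH1 v g) (hV : Continuous V) {M : ℝ}
    (hM : ∀ x, |V x| ≤ M) : IntegrableOn (fun x => g x ^ 2 + V x * v x ^ 2) (Ioi 0) := by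
  have := integrableOn_potential_mul hv.memLp hv.memLp hV hM
  simp only [← pow_two] at this
  exact (integrableOn_sq hv.memLp_deriv).add this

namespace IsRiccati

variable {V k v g : ℝ → ℝ}

theorem continuousOn (hk : IsRiccati V k) : ContinuousOn k (Ioi 0) := fun x hx =>
  (hk.hasDerivAt x hx).continuousAt.continuousWithinAt

theorem hasACDeriv (hk : IsRiccati V k) (hV : Continuous V) {a b : ℝ} (ha : 0 < a) (hab : a ≤ b) :
    HasACDeriv k (fun x => V x - k x ^ 2) a b := by
  have hs : uIcc a b ⊆ Ioi 0 := by
    rw [uIcc_of_le hab]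
    exact fun x hx => ha.trans_le hx.1
  exact .of_hasDerivAt (fun x hx => hk.hasDerivAt x (hs hx))
    (hV.continuousOn.sub ((hk.continuousOn.mono hs).pow 2))

/-- Jacobi's factorization: the Riccati equation gives $(v'-kv)^2=v'^2+Vv^2-(kv^2)'$. The interval
stays away from the vertex because $k$ may be singular there. -/
theorem integral_sq_eq (hk : IsRiccati V k) (hV : Continuous V) {M : ℝ} (hM : ∀ x, |V x| ≤ M)
    (hv : IsH1 v g) {a b : ℝ} (ha : 0 < a) (hab : a ≤ b) :
    IntervalIntegrable (fun x => (g x - k x * v x) ^ 2) volume a b ∧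
    ∫ x in a..b, (g x - k x * v x) ^ 2 =
      (∫ x in a..b, (g x ^ 2 + V x * v x ^ 2)) - (k b * v b ^ 2 - k a * v a ^ 2) := by
  have hva := hv.hasACDeriv' ha.le (ha.le.trans hab)
  have hm := (hk.hasACDeriv hV ha hab).mul (hva.mul hva)
  have hi : IntervalIntegrable (fun x => g x ^ 2 + V x * v x ^ 2) volume a b := by
    rw [intervalIntegrable_iff_integrableOn_Ioc_of_le hab]
    exact (hv.integrableOn_form hV hM).mono_set fun x hx => ha.trans hx.1
  have hfun : (fun x => (g x - k x * v x) ^ 2) = fun x => (g x ^ 2 + V x * v x ^ 2) -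
      ((V x - k x ^ 2) * (v x * v x) + k x * (g x * v x + v x * g x)) := by
    funext x; ring
  rw [hfun]
  refine ⟨hi.sub hm.intervalIntegrable, ?_⟩
  rw [intervalIntegral.integral_sub hi hm.intervalIntegrable, hm.integral_eq]
  ring

/-- Exhaustion of the half-line by $[1/(n+1),n+1]$. The boundary term at infinity vanishes since $k$
is bounded and $v^2\to0$; at the vertex it vanishes by `h0`. -/
theorem tendsto_integral_sq (hk : IsRiccati V k) (hV : Continuous V) {M : ℝ}
    (hM : ∀ x, |V x| ≤ M) (hv : IsH1 v g)
    (h0 : Tendsto (fun x => k x * v x ^ 2) (𝓝[>] 0) (𝓝 0)) :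
    Tendsto (fun n : ℕ => ∫ x in (1 / ((n : ℝ) + 1))..((n : ℝ) + 1), (g x - k x * v x) ^ 2) atTop
      (𝓝 (schrodingerForm V v g)) := by
  have hi := hv.integrableOn_form hV hM
  have hb : Tendsto (fun n : ℕ => (n : ℝ) + 1) atTop atTop :=
    tendsto_atTop_add_const_right _ _ tendsto_natCast_atTop_atTop
  have ha : Tendsto (fun n : ℕ => 1 / ((n : ℝ) + 1)) atTop (𝓝[>] 0) :=
    tendsto_nhdsWithin_iff.2 ⟨tendsto_one_div_add_atTop_nhds_zero_nat,
      Eventually.of_forall fun n => by simp only [mem_Ioi]; positivity⟩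
  have t1 := intervalIntegral_tendsto_integral_Ioi 0 hi hb
  have t2 : Tendsto (fun n : ℕ => ∫ x in (0 : ℝ)..(1 / ((n : ℝ) + 1)), (g x ^ 2 + V x * v x ^ 2))
      atTop (𝓝 0) := by
    have hc : ContinuousWithinAt (fun y => ∫ x in (0 : ℝ)..y, (g x ^ 2 + V x * v x ^ 2))
        (Icc 0 1) 0 := by
      refine intervalIntegral.continuousWithinAt_primitive (by simp) ?_
      simp only [min_self, zero_le_one, max_eq_right]
      rw [intervalIntegrable_iff_integrableOn_Ioc_of_le zero_le_one]
      exact hi.mono_set fun x hx => hx.1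
    have := hc.tendsto
    rw [intervalIntegral.integral_same] at this
    refine this.comp (tendsto_nhdsWithin_iff.2 ⟨tendsto_one_div_add_atTop_nhds_zero_nat,
      Eventually.of_forall fun n => ⟨by positivity, ?_⟩⟩)
    rw [div_le_one (by positivity)]
    linarith [Nat.cast_nonneg (α := ℝ) n]
  have t3 : Tendsto (fun n : ℕ => k ((n : ℝ) + 1) * v ((n : ℝ) + 1) ^ 2) atTop (𝓝 0) := by
    obtain ⟨B, hB⟩ := hk.bounded
    have h1 := (hv.tendsto_sq_atTop.comp hb).const_mul B
    rw [mul_zero] at h1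
    refine squeeze_zero_norm (fun n => ?_) h1
    rw [norm_mul, Real.norm_eq_abs, Real.norm_of_nonneg (sq_nonneg _)]
    exact mul_le_mul_of_nonneg_right (hB _ (by linarith [Nat.cast_nonneg (α := ℝ) n]))
      (sq_nonneg _)
  have t4 := h0.comp ha
  have key := (t1.sub t2).sub (t3.sub t4)
  simp only [sub_zero] at key
  refine key.congr fun n => ?_
  have hn : (0 : ℝ) < 1 / ((n : ℝ) + 1) := by positivity
  have hn1 : 1 / ((n : ℝ) + 1) ≤ (n : ℝ) + 1 := by
    have : (1 : ℝ) ≤ (n : ℝ) + 1 := by linarith [Nat.cast_nonneg (α := ℝ) n]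
    exact (div_le_one (by positivity)).2 this |>.trans this
  have hint : ∀ y : ℝ, 0 ≤ y →
      IntervalIntegrable (fun x => g x ^ 2 + V x * v x ^ 2) volume 0 y := fun y hy => by
    rw [intervalIntegrable_iff_integrableOn_Ioc_of_le hy]
    exact hi.mono_set fun x hx => hx.1
  rw [(hk.integral_sq_eq hV hM hv hn hn1).2,
    intervalIntegral.integral_interval_sub_left (hint _ (hn.le.trans hn1)) (hint _ hn.le)]
  rfl

/-- The integrals of a square increase along the exhausting intervals, so each is at most their
limit. -/
theorem integral_sq_le (hk : IsRiccati V k) (hV : Continuous V) {M : ℝ} (hM : ∀ x, |V x| ≤ M)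
    (hv : IsH1 v g) (h0 : Tendsto (fun x => k x * v x ^ 2) (𝓝[>] 0) (𝓝 0)) {a b : ℝ}
    (ha : 0 < a) (hab : a ≤ b) :
    ∫ x in a..b, (g x - k x * v x) ^ 2 ≤ schrodingerForm V v g := by
  refine ge_of_tendsto (hk.tendsto_integral_sq hV hM hv h0) ?_
  have e1 : ∀ᶠ n : ℕ in atTop, 1 / ((n : ℝ) + 1) < a :=
    (tendsto_order.1 tendsto_one_div_add_atTop_nhds_zero_nat).2 a ha
  have e2 : ∀ᶠ n : ℕ in atTop, b ≤ (n : ℝ) :=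
    tendsto_natCast_atTop_atTop.eventually (eventually_ge_atTop b)
  filter_upwards [e1, e2] with n h1 h2
  have hn : (0 : ℝ) < 1 / ((n : ℝ) + 1) := by positivity
  refine intervalIntegral.integral_mono_interval h1.le hab (by linarith)
    (ae_of_all _ fun x => sq_nonneg _) ?_
  exact (hk.integral_sq_eq hV hM hv hn (by linarith)).1

theorem schrodingerForm_nonneg (hk : IsRiccati V k) (hV : Continuous V) {M : ℝ}
    (hM : ∀ x, |V x| ≤ M) (hv : IsH1 v g)
    (h0 : Tendsto (fun x => k x * v x ^ 2) (𝓝[>] 0) (𝓝 0)) : 0 ≤ schrodingerForm V v g := by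
  -- The degenerate interval $[1,1]$ already gives the lower bound zero.
  simpa using hk.integral_sq_le hV hM hv h0 one_pos le_rfl

/-- The form vanishes only on multiples of the positive solution `ψ` of `ψ' = k ψ`. -/
theorem eq_const_mul_of_schrodingerForm_eq_zero (hk : IsRiccati V k) (hV : Continuous V) {M : ℝ}
    (hM : ∀ x, |V x| ≤ M) (hv : IsH1 v g)
    (h0 : Tendsto (fun x => k x * v x ^ 2) (𝓝[>] 0) (𝓝 0)) {ψ : ℝ → ℝ}
    (hψ : ∀ x, 0 < x → HasDerivAt ψ (k x * ψ x) x) (hψ0 : ∀ x, 0 < x → ψ x ≠ 0)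
    (hz : schrodingerForm V v g = 0) : ∃ c, ∀ x, 0 < x → v x = c * ψ x := by
  -- The quotient $v/\psi$ has derivative $(v'-kv)/\psi$, which is zero almost everywhere; absolute
  -- continuity makes the quotient constant.
  have main : ∀ a b, 0 < a → a ≤ b → (ψ b)⁻¹ * v b = (ψ a)⁻¹ * v a := by
    intro a b ha hab
    have hs : uIcc a b ⊆ Ioi 0 := by
      rw [uIcc_of_le hab]
      exact fun x hx => ha.trans_le hx.1
    obtain ⟨hi, -⟩ := hk.integral_sq_eq hV hM hv ha hab
    have hle := hk.integral_sq_le hV hM hv h0 ha hab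
    rw [hz] at hle
    have hae : (fun x => (g x - k x * v x) ^ 2) =ᵐ[volume.restrict (Ioc a b)] 0 :=
      (intervalIntegral.integral_eq_zero_iff_of_le_of_nonneg_ae hab
        (ae_of_all _ fun x => sq_nonneg _) hi).1
        (le_antisymm hle (intervalIntegral.integral_nonneg hab fun x _ => sq_nonneg _))
    have hψc : ContinuousOn ψ (uIcc a b) := fun x hx =>
      (hψ x (hs hx)).continuousAt.continuousWithinAt
    have hinv : HasACDeriv (fun x => (ψ x)⁻¹) (fun x => -(k x * ψ x) / ψ x ^ 2) a b :=
      .of_hasDerivAt (fun x hx => (hψ x (hs hx)).inv (hψ0 x (hs hx)))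
        ((((hk.continuousOn.mono hs).mul hψc).neg).div (hψc.pow 2)
          fun x hx => pow_ne_zero 2 (hψ0 x (hs hx)))
    have := (hinv.mul (hv.hasACDeriv' ha.le (ha.le.trans hab))).integral_eq
    rw [intervalIntegral.integral_congr_ae (g := fun _ => 0), intervalIntegral.integral_zero]
      at this
    · linarith
    · rw [Filter.EventuallyEq, ae_restrict_iff' measurableSet_Ioc] at hae
      filter_upwards [hae] with x hx hm
      rw [uIoc_of_le hab] at hm
      have hg : g x = k x * v x := by
        have := hx hm
        simp only [Pi.zero_apply] at this
        linarith [pow_eq_zero_iff (two_ne_zero) |>.1 this]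
      have := hψ0 x (ha.trans hm.1)
      rw [hg]
      field_simp
      ring
  refine ⟨(ψ 1)⁻¹ * v 1, fun x hx => ?_⟩
  have := hψ0 x hx
  have h1 : (ψ x)⁻¹ * v x = (ψ 1)⁻¹ * v 1 := by
    rcases le_total x 1 with h | h
    · exact (main x 1 hx h).symm
    · exact main 1 x one_pos h
  rw [← h1]
  field_simp

theorem schrodingerForm_eq_zero (hk : IsRiccati V k) (hV : Continuous V) {M : ℝ}
    (hM : ∀ x, |V x| ≤ M) (hv : IsH1 v g)
    (h0 : Tendsto (fun x => k x * v x ^ 2) (𝓝[>] 0) (𝓝 0)) (hg : ∀ x, 0 < x → g x = k x * v x) :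
    schrodingerForm V v g = 0 := by
  refine tendsto_nhds_unique (hk.tendsto_integral_sq hV hM hv h0)
    (tendsto_const_nhds.congr fun n => ?_)
  symm
  rw [intervalIntegral.integral_congr (g := fun _ => (0 : ℝ)), intervalIntegral.integral_zero]
  intro x hx
  have hx0 : 0 < x := lt_of_lt_of_le (lt_min (by positivity) (by positivity)) hx.1
  simp [hg x hx0]

end IsRiccati

/-! ### Integration by parts and behaviour at the vertex. -/

namespace IsH1

variable {v w g h : ℝ → ℝ}

theorem tendsto_mul_atTop (hv : IsH1 v g) (hw : IsH1 w h) :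
    Tendsto (fun x => v x * w x) atTop (𝓝 0) := by
  have := hv.tendsto_sq_atTop.add hw.tendsto_sq_atTop
  rw [add_zero] at this
  refine squeeze_zero_norm (fun x => ?_) this
  rw [norm_mul, Real.norm_eq_abs, Real.norm_eq_abs, ← sq_abs (v x), ← sq_abs (w x)]
  nlinarith [sq_nonneg (|v x| - |w x|), sq_nonneg (|v x|), sq_nonneg (|w x|)]

/-- Integration by parts on the half-line. -/
theorem integral_deriv_mul_add (hv : IsH1 v g) (hw : IsH1 w h) :
    ∫ x in Ioi (0 : ℝ), (g x * w x + v x * h x) = -(v 0 * w 0) := by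
  have hi : IntegrableOn (fun x => g x * w x + v x * h x) (Ioi 0) :=
    (integrableOn_mul hv.memLp_deriv hw.memLp).add (integrableOn_mul hv.memLp hw.memLp_deriv)
  have h1 := intervalIntegral_tendsto_integral_Ioi 0 hi tendsto_id
  have h2 := (hv.tendsto_mul_atTop hw).sub_const (v 0 * w 0)
  rw [zero_sub] at h2
  refine tendsto_nhds_unique h1 (h2.congr' ?_)
  filter_upwards [eventually_ge_atTop 0] with x hx
  exact (((hv.hasACDeriv x hx).mul (hw.hasACDeriv x hx)).integral_eq).symm

/-- Cauchy–Schwarz, obtained by expanding $\int_0^x(g-v(x)/x)^2\ge0$, where $v(x)/x$ is the mean of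
$g$ on $(0,x)$. -/
theorem sq_le_mul_integral (hv : IsH1 v g) (h0 : v 0 = 0) {x : ℝ} (hx : 0 < x) :
    v x ^ 2 ≤ x * ∫ y in (0 : ℝ)..x, g y ^ 2 := by
  have hac := hv.hasACDeriv x hx.le
  have hg1 := hac.intervalIntegrable
  have hg2 : IntervalIntegrable (fun y => g y ^ 2) volume 0 x := by
    rw [intervalIntegrable_iff_integrableOn_Ioc_of_le hx.le]
    exact (integrableOn_sq hv.memLp_deriv).mono_set fun y hy => hy.1
  have e := hac.integral_eq
  rw [h0, sub_zero] at e
  have key : 0 ≤ ∫ y in (0 : ℝ)..x, (g y - v x / x) ^ 2 :=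
    intervalIntegral.integral_nonneg hx.le fun y _ => sq_nonneg _
  have hfun : (fun y => (g y - v x / x) ^ 2) =
      fun y => g y ^ 2 - (2 * (v x / x)) * g y + (v x / x) ^ 2 := by
    funext y; ring
  rw [hfun, intervalIntegral.integral_add (hg2.sub (hg1.const_mul _)) (by simp),
    intervalIntegral.integral_sub hg2 (hg1.const_mul _), intervalIntegral.integral_const_mul, e,
    intervalIntegral.integral_const, sub_zero, smul_eq_mul] at key
  have : (∫ y in (0 : ℝ)..x, g y ^ 2) - 2 * (v x / x) * v x + x * (v x / x) ^ 2 =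
      (∫ y in (0 : ℝ)..x, g y ^ 2) - v x ^ 2 / x := by
    field_simp; ring
  rw [this, sub_nonneg, div_le_iff₀ hx] at key
  linarith

/-- A pole of order one is harmless: $|k|v^2\le|xk|\int_0^xg^2$, and the last integral tends to
zero. -/
theorem tendsto_mul_sq_nhds_zero (hv : IsH1 v g) (h0 : v 0 = 0) {k : ℝ → ℝ} {B : ℝ}
    (hk : ∀ x, 0 < x → x ≤ 1 → |x * k x| ≤ B) :
    Tendsto (fun x => k x * v x ^ 2) (𝓝[>] 0) (𝓝 0) := by
  have hc : ContinuousWithinAt (fun y => ∫ x in (0 : ℝ)..y, g x ^ 2) (Icc 0 1) 0 := by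
    refine intervalIntegral.continuousWithinAt_primitive (by simp) ?_
    simp only [min_self, zero_le_one, max_eq_right]
    rw [intervalIntegrable_iff_integrableOn_Ioc_of_le zero_le_one]
    exact (integrableOn_sq hv.memLp_deriv).mono_set fun x hx => hx.1
  have t := hc.tendsto
  rw [intervalIntegral.integral_same] at t
  have hI : Icc (0 : ℝ) 1 ∈ 𝓝[>] 0 := Icc_mem_nhdsGT one_pos
  have t' := (t.mono_left (nhdsWithin_le_of_mem hI)).const_mul B
  rw [mul_zero] at t'
  refine squeeze_zero_norm' ?_ t'
  filter_upwards [hI, self_mem_nhdsWithin] with x hx hx0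
  have hx0 : 0 < x := hx0
  rw [norm_mul, Real.norm_eq_abs, Real.norm_of_nonneg (sq_nonneg _)]
  have h1 := hv.sq_le_mul_integral h0 hx0
  have h2 := hk x hx0 hx.2
  rw [abs_mul, abs_of_pos hx0] at h2
  have hI0 : 0 ≤ ∫ y in (0 : ℝ)..x, g y ^ 2 :=
    intervalIntegral.integral_nonneg hx0.le fun y _ => sq_nonneg _
  calc |k x| * v x ^ 2 ≤ |k x| * (x * ∫ y in (0 : ℝ)..x, g y ^ 2) :=
        mul_le_mul_of_nonneg_left h1 (abs_nonneg _)
    _ = (x * |k x|) * ∫ y in (0 : ℝ)..x, g y ^ 2 := by ring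
    _ ≤ _ := mul_le_mul_of_nonneg_right h2 hI0

end IsH1

/-- The mixed term of `schrodingerForm`. -/
def schrodingerBilin (V v g w h : ℝ → ℝ) : ℝ :=
  ∫ x in Ioi (0 : ℝ), (g x * h x + V x * (v x * w x))

theorem schrodingerForm_add_const_mul {V v g w h : ℝ → ℝ} (hV : Continuous V) {M : ℝ}
    (hM : ∀ x, |V x| ≤ M) (hv : IsH1 v g) (hw : IsH1 w h) (s : ℝ) :
    schrodingerForm V (fun x => v x + s * w x) (fun x => g x + s * h x) =
      schrodingerForm V v g + 2 * s * schrodingerBilin V v g w h +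
        s ^ 2 * schrodingerForm V w h := by
  have i1 := hv.integrableOn_form hV hM
  have i2 := hw.integrableOn_form hV hM
  have i3 : IntegrableOn (fun x => g x * h x + V x * (v x * w x)) (Ioi 0) :=
    (IsH1.integrableOn_mul hv.memLp_deriv hw.memLp_deriv).add
      (IsH1.integrableOn_potential_mul hv.memLp hw.memLp hV hM)
  have i4 : IntegrableOn (fun x => g x ^ 2 + V x * v x ^ 2 +
      2 * s * (g x * h x + V x * (v x * w x))) (Ioi 0) := i1.add (i3.const_mul _)
  unfold schrodingerForm schrodingerBilin
  rw [← integral_const_mul, ← integral_const_mul, ← integral_add i1 (i3.const_mul _),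
    ← integral_add i4 (i2.const_mul _)]
  congr 1; ext x; ring

/-! ### The soliton and the two linearized forms on one edge. -/

section Soliton

variable {p : ℝ}

theorem hasDerivAt_tanh_mul (p x : ℝ) :
    HasDerivAt (fun y => Real.tanh (p * y)) (p * (1 - Real.tanh (p * x) ^ 2)) x := by
  have h := ((hasDerivAt_id x).const_mul p)
  have hc := (Real.cosh_pos (p * x)).ne'
  have h1 := h.sinh.div h.cosh hc
  have e : (fun y => Real.tanh (p * y)) = fun y => Real.sinh (p * y) / Real.cosh (p * y) :=
    funext fun y => Real.tanh_eq_sinh_div_cosh _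
  rw [e, Real.tanh_eq_sinh_div_cosh]
  convert! h1 using 1
  simp only [id]
  field_simp

theorem continuous_tanh_mul (p : ℝ) : Continuous fun x => Real.tanh (p * x) :=
  continuous_iff_continuousAt.2 fun x => (hasDerivAt_tanh_mul p x).continuousAt

theorem tanh_sq_le_one (x : ℝ) : Real.tanh x ^ 2 ≤ 1 := by
  rw [sq_le_one_iff_abs_le_one]
  exact (Real.abs_tanh_lt_one x).le

theorem tanh_mul_pos (hp : 0 < p) {x : ℝ} (hx : 0 < x) : 0 < Real.tanh (p * x) := by
  rw [Real.tanh_eq_sinh_div_cosh]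
  exact div_pos (Real.sinh_pos_iff.2 (mul_pos hp hx)) (Real.cosh_pos _)

theorem monotone_tanh_mul (hp : 0 < p) : Monotone fun x => Real.tanh (p * x) :=
  monotone_of_deriv_nonneg (fun x => (hasDerivAt_tanh_mul p x).differentiableAt) fun x => by
    rw [(hasDerivAt_tanh_mul p x).deriv]
    exact mul_nonneg hp.le (sub_nonneg.2 (tanh_sq_le_one _))

theorem soliton_pos (p x : ℝ) : 0 < soliton p x :=
  Real.rpow_pos_of_pos (by have := Real.cosh_pos (p * x); positivity) _

theorem soliton_zero (p : ℝ) : soliton p 0 = 1 := by simp [soliton]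

/-- Turns the nonlinear coefficient $\varphi^{2p}$ into $\mathrm{sech}^2(px)$, after which the
potentials are polynomials in $\tanh(px)$. -/
theorem soliton_rpow (hp : 0 < p) (x : ℝ) :
    soliton p x ^ (2 * p) = 1 - Real.tanh (p * x) ^ 2 := by
  have hc := Real.cosh_pos (p * x)
  rw [soliton, ← Real.rpow_mul (by positivity)]
  have : 1 / p * (2 * p) = (2 : ℕ) := by push_cast; field_simp
  rw [this, Real.rpow_natCast, Real.tanh_eq_sinh_div_cosh, div_pow, div_pow, Real.sinh_sq]
  field_simp
  ring

/-- The potential of the linearized operator acting on real parts. -/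
def realPotential (p x : ℝ) : ℝ := 1 - (2 * p + 1) * (p + 1) * (1 - Real.tanh (p * x) ^ 2)

/-- The potential of the linearized operator acting on imaginary parts. -/
def imagPotential (p x : ℝ) : ℝ := 1 - (p + 1) * (1 - Real.tanh (p * x) ^ 2)

theorem continuous_realPotential (p : ℝ) : Continuous (realPotential p) := by
  have := continuous_tanh_mul p
  unfold realPotential
  fun_prop

theorem continuous_imagPotential (p : ℝ) : Continuous (imagPotential p) := by
  have := continuous_tanh_mul p
  unfold imagPotential
  fun_prop

theorem abs_realPotential_le (hp : 0 < p) (x : ℝ) :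
    |realPotential p x| ≤ 1 + (2 * p + 1) * (p + 1) := by
  have h1 := tanh_sq_le_one (p * x)
  have h2 := sq_nonneg (Real.tanh (p * x))
  have h3 : 0 < (2 * p + 1) * (p + 1) := by positivity
  unfold realPotential
  rw [abs_le]
  constructor <;> nlinarith

theorem abs_imagPotential_le (hp : 0 < p) (x : ℝ) : |imagPotential p x| ≤ 1 + (p + 1) := by
  have h1 := tanh_sq_le_one (p * x)
  have h2 := sq_nonneg (Real.tanh (p * x))
  unfold imagPotential
  rw [abs_le]
  constructor <;> nlinarith

/-- This $k$ is $\varphi'/\varphi$. -/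
theorem isRiccati_imag (p : ℝ) :
    IsRiccati (imagPotential p) (fun x => -Real.tanh (p * x)) := by
  refine ⟨fun x _ => ?_, 1, fun x _ => ?_⟩
  · convert! (hasDerivAt_tanh_mul p x).neg using 1
    unfold imagPotential; ring
  · rw [abs_neg]; exact (Real.abs_tanh_lt_one _).le

/-- Since $k=-\tanh(px)$ vanishes at the vertex, the boundary term disappears whatever the value of
$v(0)$. -/
theorem imagForm_nonneg (hp : 0 < p) {v g : ℝ → ℝ} (hv : IsH1 v g) :
    0 ≤ schrodingerForm (imagPotential p) v g ∧
      (schrodingerForm (imagPotential p) v g = 0 → ∃ c, ∀ x, 0 < x → v x = c * soliton p x) := by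
  have h0 : Tendsto (fun x => -Real.tanh (p * x) * v x ^ 2) (𝓝[>] 0) (𝓝 0) := by
    have h1 : Tendsto v (𝓝[>] 0) (𝓝 (v 0)) :=
      (hv.continuousOn 0 self_mem_Ici).tendsto.mono_left (nhdsWithin_mono _ Ioi_subset_Ici_self)
    have h2 : Tendsto (fun x => Real.tanh (p * x)) (𝓝[>] 0) (𝓝 (Real.tanh (p * 0))) :=
      (continuous_tanh_mul p).continuousAt.tendsto.mono_left nhdsWithin_le_nhds
    have := h2.neg.mul (h1.pow 2)
    simpa using this
  have hV := continuous_imagPotential p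
  have hM := abs_imagPotential_le hp
  refine ⟨(isRiccati_imag p).schrodingerForm_nonneg hV hM hv h0, fun hz =>
    (isRiccati_imag p).eq_const_mul_of_schrodingerForm_eq_zero hV hM hv h0
      (fun x _ => ?_) (fun x _ => (soliton_pos p x).ne') hz⟩
  convert hasDerivAt_soliton hp x using 1
  ring

/-- This $k$ is $\varphi''/\varphi'$; the derivative $\varphi'$ solves the differentiated stationary
equation and its only zero on $[0,\infty)$ is the vertex, where $k$ has a pole. -/
theorem isRiccati_real (hp : 0 < p) :
    IsRiccati (realPotential p) (fun x => p / Real.tanh (p * x) - (p + 1) * Real.tanh (p * x)) := by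
  refine ⟨fun x hx => ?_, p / Real.tanh p + (p + 1), fun x hx => ?_⟩
  · have ht := (tanh_mul_pos hp hx).ne'
    have h := hasDerivAt_tanh_mul p x
    convert! ((hasDerivAt_const x p).div h ht).sub (h.const_mul (p + 1)) using 1
    unfold realPotential
    field_simp
    ring
  · have hx0 : 0 < x := one_pos.trans_le hx
    have ht := tanh_mul_pos hp hx0
    have ht1 := tanh_mul_pos hp one_pos
    rw [mul_one] at ht1
    have hle : Real.tanh p ≤ Real.tanh (p * x) := by
      simpa using monotone_tanh_mul hp hx
    have hlt := (abs_lt.1 (Real.abs_tanh_lt_one (p * x))).2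
    have hd : p / Real.tanh (p * x) ≤ p / Real.tanh p := by gcongr
    have hd0 : 0 < p / Real.tanh (p * x) := by positivity
    rw [abs_le]
    constructor <;> nlinarith

theorem tendsto_realRiccati_mul_sq (hp : 0 < p) {v g : ℝ → ℝ} (hv : IsH1 v g) (h0 : v 0 = 0) :
    Tendsto (fun x => (p / Real.tanh (p * x) - (p + 1) * Real.tanh (p * x)) * v x ^ 2)
      (𝓝[>] 0) (𝓝 0) := by
  -- On $(0,1]$, $xp/\tanh(px)=\frac{px}{\sinh(px)}\cosh(px)\le\cosh p$, and the other term is at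
  -- most $p+1$.
  refine hv.tendsto_mul_sq_nhds_zero h0 (B := Real.cosh p + (p + 1)) fun x hx hx1 => ?_
  have ht := tanh_mul_pos hp hx
  have hlt := (abs_lt.1 (Real.abs_tanh_lt_one (p * x))).2
  have hc := Real.cosh_pos (p * x)
  have h1 : x * (p / Real.tanh (p * x)) ≤ Real.cosh p := by
    have hs : p * x ≤ Real.sinh (p * x) := Real.self_le_sinh_iff.2 (by positivity)
    have hcc : Real.cosh (p * x) ≤ Real.cosh p := by
      rw [Real.cosh_le_cosh, abs_of_pos (by positivity), abs_of_pos hp]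
      nlinarith
    have hs0 : 0 < Real.sinh (p * x) := lt_of_lt_of_le (by positivity) hs
    rw [Real.tanh_eq_sinh_div_cosh]
    calc x * (p / (Real.sinh (p * x) / Real.cosh (p * x)))
        = (p * x / Real.sinh (p * x)) * Real.cosh (p * x) := by field_simp
      _ ≤ 1 * Real.cosh (p * x) := by
          gcongr
          exact (div_le_one hs0).2 hs
      _ ≤ _ := by rw [one_mul]; exact hcc
  have h2 : 0 < x * (p / Real.tanh (p * x)) := by positivity
  have h3 : x * ((p + 1) * Real.tanh (p * x)) ≤ p + 1 := by
    have : x * Real.tanh (p * x) ≤ 1 := by nlinarith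
    nlinarith
  have h4 : 0 < x * ((p + 1) * Real.tanh (p * x)) := by positivity
  have h5 := Real.cosh_pos p
  rw [mul_sub, abs_le]
  constructor <;> linarith

theorem hasDerivAt_deriv_soliton (hp : 0 < p) (x : ℝ) :
    HasDerivAt (deriv (soliton p))
      (soliton p x * (Real.tanh (p * x) ^ 2 - p * (1 - Real.tanh (p * x) ^ 2))) x := by
  rw [deriv_soliton hp]
  convert! ((hasDerivAt_soliton hp x).mul (hasDerivAt_tanh_mul p x)).neg using 1
  ring

/-- The Dirichlet condition compensates the pole of $\varphi''/\varphi'$ at the vertex. -/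
theorem realForm_nonneg (hp : 0 < p) {v g : ℝ → ℝ} (hv : IsH1 v g) (h0 : v 0 = 0) :
    0 ≤ schrodingerForm (realPotential p) v g ∧
      (schrodingerForm (realPotential p) v g = 0 →
        ∃ c, ∀ x, 0 < x → v x = c * deriv (soliton p) x) := by
  have hV := continuous_realPotential p
  have hM := abs_realPotential_le hp
  have ht := tendsto_realRiccati_mul_sq hp hv h0
  refine ⟨(isRiccati_real hp).schrodingerForm_nonneg hV hM hv ht, fun hz =>
    (isRiccati_real hp).eq_const_mul_of_schrodingerForm_eq_zero hV hM hv ht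
      (fun x hx => ?_) (fun x hx => ?_) hz⟩
  · convert hasDerivAt_deriv_soliton hp x using 1
    rw [deriv_soliton hp]
    have := (tanh_mul_pos hp hx).ne'
    field_simp
    ring
  · rw [deriv_soliton hp]
    exact neg_ne_zero.2 (mul_pos (soliton_pos p x) (tanh_mul_pos hp hx)).ne'

/-- The linear factor is absorbed by half of the exponential decay: $1+x\le2e^{x/2}$. It is needed
for the terms $x\varphi$ produced by scaling. -/
theorem memLp_of_le_mul_soliton (hp : 0 < p) {f : ℝ → ℝ} (hf : Continuous f) {C : ℝ}
    (hb : ∀ x, 0 < x → |f x| ≤ C * (1 + x) * soliton p x) : MemLp f 2 edgeMeasure := by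
  have hC : 0 ≤ C := by
    have h1 := (abs_nonneg _).trans (hb 1 one_pos)
    have h2 := soliton_pos p 1
    by_contra hcon
    nlinarith
  rw [memLp_two_iff_integrable_sq hf.aestronglyMeasurable]
  have hi : Integrable (fun x : ℝ => (C * 2 * 2 ^ (1 / p)) ^ 2 * Real.exp (-1 * x)) edgeMeasure :=
    (integrableOn_exp_mul_Ioi (a := -1) (by norm_num) 0).const_mul _
  refine hi.mono' (by fun_prop) ?_
  filter_upwards [ae_restrict_mem measurableSet_Ioi] with x hx
  have hx : 0 < x := hx
  rw [Real.norm_of_nonneg (sq_nonneg _), ← sq_abs]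
  calc |f x| ^ 2 ≤ (C * 2 * 2 ^ (1 / p) * Real.exp (-(x / 2))) ^ 2 := by
        gcongr
        refine (hb x hx).trans ?_
        have h1 : 1 + x ≤ 2 * Real.exp (x / 2) := by
          have := Real.add_one_le_exp (x / 2)
          linarith
        have h2 := soliton_le hp x
        have h0 := soliton_nonneg p x
        have h3 : Real.exp (x / 2) * Real.exp (-x) = Real.exp (-(x / 2)) := by
          rw [← Real.exp_add]; congr 1; ring
        calc C * (1 + x) * soliton p x
            ≤ C * (2 * Real.exp (x / 2)) * (2 ^ (1 / p) * Real.exp (-x)) := by gcongr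
          _ = C * 2 * 2 ^ (1 / p) * (Real.exp (x / 2) * Real.exp (-x)) := by ring
          _ = _ := by rw [h3]
    _ = _ := by
        rw [mul_pow, ← Real.exp_nat_mul]
        congr 2
        push_cast; ring

theorem isH1_soliton (hp : 0 < p) : IsH1 (soliton p) (deriv (soliton p)) := by
  have hc := continuous_soliton hp
  have hc' := continuous_deriv_soliton hp
  refine .of_hasDerivAt (fun x => (hasDerivAt_soliton hp x).differentiableAt.hasDerivAt) hc'
    (memLp_of_le_mul_soliton hp hc (C := 1) fun x hx => ?_)
    (memLp_of_le_mul_soliton hp hc' (C := 1) fun x hx => ?_)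
  · rw [abs_of_pos (soliton_pos p x)]
    nlinarith [soliton_pos p x]
  · rw [deriv_soliton hp, abs_neg, abs_mul, abs_of_pos (soliton_pos p x)]
    have := soliton_pos p x
    have h1 := (Real.abs_tanh_lt_one (p * x)).le
    have h2 : soliton p x * |Real.tanh (p * x)| ≤ soliton p x * 1 := by gcongr
    nlinarith

theorem isH1_deriv_soliton (hp : 0 < p) : IsH1 (deriv (soliton p))
    (fun x => soliton p x * (Real.tanh (p * x) ^ 2 - p * (1 - Real.tanh (p * x) ^ 2))) := by
  have hc := continuous_soliton hp
  have ht := continuous_tanh_mul p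
  refine .of_hasDerivAt (hasDerivAt_deriv_soliton hp) (by fun_prop) (isH1_soliton hp).memLp_deriv
    (memLp_of_le_mul_soliton hp (by fun_prop) (C := 1 + p) fun x hx => ?_)
  have hs := soliton_pos p x
  have h1 := tanh_sq_le_one (p * x)
  have h2 := sq_nonneg (Real.tanh (p * x))
  rw [abs_mul, abs_of_pos hs, mul_comm]
  gcongr
  rw [abs_le]
  constructor <;> nlinarith

/-- The function $\varphi'$ vanishes at the vertex and satisfies $v'=kv$, so the factorized
integrand is zero. -/
theorem realForm_deriv_soliton (hp : 0 < p) :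
    schrodingerForm (realPotential p) (deriv (soliton p))
      (fun x => soliton p x * (Real.tanh (p * x) ^ 2 - p * (1 - Real.tanh (p * x) ^ 2))) = 0 := by
  have h0 : deriv (soliton p) 0 = 0 := by rw [deriv_soliton hp]; simp
  refine (isRiccati_real hp).schrodingerForm_eq_zero (continuous_realPotential p)
    (abs_realPotential_le hp) (isH1_deriv_soliton hp)
    (tendsto_realRiccati_mul_sq hp (isH1_deriv_soliton hp) h0) fun x hx => ?_
  rw [deriv_soliton hp]
  have := (tanh_mul_pos hp hx).ne'
  field_simp
  ring

/-- The integrand is $\frac12(\varphi^2)'$ and $\varphi(0)=1$. That the value is not zero is what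
turns the constraint on $c\varphi'$ into $\sum c_j=0$. -/
theorem integral_soliton_mul_deriv (hp : 0 < p) :
    ∫ x in Ioi (0 : ℝ), deriv (soliton p) x * soliton p x = -(1 / 2) := by
  have h := (isH1_soliton hp).integral_deriv_mul_add (isH1_soliton hp)
  have e : (fun x => deriv (soliton p) x * soliton p x + soliton p x * deriv (soliton p) x) =
      fun x => 2 * (deriv (soliton p) x * soliton p x) := by funext x; ring
  rw [e, integral_const_mul, soliton_zero] at h
  linarith

end Soliton

/-! ### The scaling generator $\chi$ and the condition $p<2$. -/

section ScalingGenerator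

variable {p : ℝ}

/-- The derivative at `ω = 1` of the rescaled profile `ω^{1/(2p)} φ(√ω x)`. -/
def scalingGenerator (p x : ℝ) : ℝ :=
  soliton p x * (1 / (2 * p) - x * Real.tanh (p * x) / 2)

/-- The derivative of `scalingGenerator`. -/
def scalingGeneratorDeriv (p x : ℝ) : ℝ :=
  -(soliton p x * Real.tanh (p * x)) * (1 / (2 * p) - x * Real.tanh (p * x) / 2) -
    soliton p x * (Real.tanh (p * x) / 2 + x * p * (1 - Real.tanh (p * x) ^ 2) / 2)

theorem hasDerivAt_scalingGenerator (hp : 0 < p) (x : ℝ) :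
    HasDerivAt (scalingGenerator p) (scalingGeneratorDeriv p x) x := by
  have h1 := ((hasDerivAt_id x).mul (hasDerivAt_tanh_mul p x)).div_const 2
  have h2 := (hasDerivAt_soliton hp x).mul (h1.const_sub (1 / (2 * p)))
  convert! h2 using 1
  simp only [scalingGeneratorDeriv, id, Pi.mul_apply]
  ring

/-- The equation $\chi''=V_+\chi+\varphi$ is the $\omega$-derivative at $\omega=1$ of
$-\varphi_\omega''+\omega\varphi_\omega-(p+1)\varphi_\omega^{2p+1}=0$; it is verified directly on
the closed formulas. -/
theorem hasDerivAt_scalingGeneratorDeriv (hp : 0 < p) (x : ℝ) :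
    HasDerivAt (scalingGeneratorDeriv p)
      (realPotential p x * scalingGenerator p x + soliton p x) x := by
  have hs := hasDerivAt_soliton hp x
  have ht := hasDerivAt_tanh_mul p x
  have h1 := (((hasDerivAt_id x).mul ht).div_const 2).const_sub (1 / (2 * p))
  have h2 := (ht.div_const 2).add
    ((((hasDerivAt_id x).mul_const p).mul ((ht.pow 2).const_sub 1)).div_const 2)
  have h3 := ((hs.mul ht).neg.mul h1).sub (hs.mul h2)
  convert! h3 using 1
  simp only [realPotential, scalingGenerator, id, Pi.mul_apply, Pi.neg_apply, Pi.add_apply,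
    Pi.pow_apply]
  field_simp
  push_cast
  ring

theorem scalingGenerator_zero (p : ℝ) : scalingGenerator p 0 = 1 / (2 * p) := by
  simp [scalingGenerator, soliton_zero]

theorem scalingGeneratorDeriv_zero (p : ℝ) : scalingGeneratorDeriv p 0 = 0 := by
  simp [scalingGeneratorDeriv]

theorem abs_scalingGenerator_le (hp : 0 < p) {x : ℝ} (hx : 0 < x) :
    |scalingGenerator p x| ≤ (1 / (2 * p) + 1) * (1 + x) * soliton p x := by
  have hs := soliton_pos p x
  have ht := tanh_mul_pos hp hx
  have ht1 := (abs_lt.1 (Real.abs_tanh_lt_one (p * x))).2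
  have hq : 0 < 1 / (2 * p) := by positivity
  have hxt : x * Real.tanh (p * x) ≤ x := by nlinarith
  have hxt0 : 0 < x * Real.tanh (p * x) := by positivity
  have hqx : 0 < 1 / (2 * p) * x := by positivity
  rw [scalingGenerator, abs_mul, abs_of_pos hs, mul_comm]
  gcongr
  rw [abs_le]
  constructor <;> nlinarith

theorem isH1_scalingGenerator (hp : 0 < p) :
    IsH1 (scalingGenerator p) (scalingGeneratorDeriv p) := by
  have hc := continuous_soliton hp
  have ht := continuous_tanh_mul p
  have hc1 : Continuous (scalingGenerator p) := by unfold scalingGenerator; fun_prop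
  have hc2 : Continuous (scalingGeneratorDeriv p) := by unfold scalingGeneratorDeriv; fun_prop
  refine .of_hasDerivAt (hasDerivAt_scalingGenerator hp) hc2
    (memLp_of_le_mul_soliton hp hc1 fun x hx => abs_scalingGenerator_le hp hx)
    (memLp_of_le_mul_soliton hp hc2 (C := 1 / (2 * p) + 1 + 1 + p) fun x hx => ?_)
  have hs := soliton_pos p x
  have h0 := tanh_mul_pos hp hx
  have h1 := (abs_lt.1 (Real.abs_tanh_lt_one (p * x))).2
  have hq : 0 < 1 / (2 * p) := by positivity
  have e : scalingGeneratorDeriv p x = -(scalingGenerator p x * Real.tanh (p * x)) -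
      soliton p x * (Real.tanh (p * x) / 2 + x * p * (1 - Real.tanh (p * x) ^ 2) / 2) := by
    unfold scalingGeneratorDeriv scalingGenerator; ring
  have b1 : |scalingGenerator p x * Real.tanh (p * x)| ≤
      (1 / (2 * p) + 1) * (1 + x) * soliton p x := by
    rw [abs_mul, abs_of_pos h0]
    have := abs_scalingGenerator_le hp hx
    have h3 := abs_nonneg (scalingGenerator p x)
    nlinarith
  have b2 : |soliton p x * (Real.tanh (p * x) / 2 + x * p * (1 - Real.tanh (p * x) ^ 2) / 2)| ≤
      (1 + p) * (1 + x) * soliton p x := by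
    rw [abs_mul, abs_of_pos hs, mul_comm]
    gcongr
    have hxp : 0 < x * p := by positivity
    have h2 : 0 < 1 - Real.tanh (p * x) ^ 2 := by nlinarith
    have h3 : x * p * (1 - Real.tanh (p * x) ^ 2) ≤ x * p := by
      nlinarith [sq_nonneg (Real.tanh (p * x))]
    have h4 : 0 < x * p * (1 - Real.tanh (p * x) ^ 2) := by positivity
    rw [abs_le]
    constructor <;> nlinarith
  rw [e]
  calc _ ≤ |-(scalingGenerator p x * Real.tanh (p * x))| +
        |soliton p x * (Real.tanh (p * x) / 2 + x * p * (1 - Real.tanh (p * x) ^ 2) / 2)| :=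
        abs_sub _ _
    _ ≤ (1 / (2 * p) + 1) * (1 + x) * soliton p x + (1 + p) * (1 + x) * soliton p x := by
        rw [abs_neg]; exact add_le_add b1 b2
    _ = _ := by ring

theorem isH1_scalingGeneratorDeriv (hp : 0 < p) : IsH1 (scalingGeneratorDeriv p)
    (fun x => realPotential p x * scalingGenerator p x + soliton p x) := by
  have hV := continuous_realPotential p
  have hc := continuous_soliton hp
  have hg : Continuous (scalingGenerator p) := continuous_iff_continuousAt.2 fun x =>
    (hasDerivAt_scalingGenerator hp x).continuousAt
  refine .of_hasDerivAt (hasDerivAt_scalingGeneratorDeriv hp) (by fun_prop)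
    (isH1_scalingGenerator hp).memLp_deriv (memLp_of_le_mul_soliton hp (by fun_prop)
      (C := (1 + (2 * p + 1) * (p + 1)) * (1 / (2 * p) + 1) + 1) fun x hx => ?_)
  have hs := soliton_pos p x
  calc |realPotential p x * scalingGenerator p x + soliton p x|
      ≤ |realPotential p x| * |scalingGenerator p x| + soliton p x := by
        refine (abs_add_le _ _).trans ?_
        rw [abs_mul, abs_of_pos hs]
    _ ≤ (1 + (2 * p + 1) * (p + 1)) * ((1 / (2 * p) + 1) * (1 + x) * soliton p x) +
          1 * (1 + x) * soliton p x := by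
        gcongr
        · exact abs_realPotential_le hp x
        · exact abs_scalingGenerator_le hp hx
        · nlinarith
    _ = _ := by ring

/-- The scaling generator is mapped to `-φ` by the linearized operator, in weak form. -/
theorem schrodingerBilin_scalingGenerator (hp : 0 < p) {v g : ℝ → ℝ} (hv : IsH1 v g) :
    schrodingerBilin (realPotential p) v g (scalingGenerator p) (scalingGeneratorDeriv p) =
      -∫ x in Ioi (0 : ℝ), v x * soliton p x := by
  have hχ := isH1_scalingGenerator hp
  have h := hv.integral_deriv_mul_add (isH1_scalingGeneratorDeriv hp)
  -- The boundary term is $v(0)\chi'(0)=0$, so no vertex condition on `v` is needed.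
  rw [scalingGeneratorDeriv_zero, mul_zero, neg_zero] at h
  have i1 : IntegrableOn (fun x => g x * scalingGeneratorDeriv p x +
      realPotential p x * (v x * scalingGenerator p x)) (Ioi 0) :=
    (IsH1.integrableOn_mul hv.memLp_deriv hχ.memLp_deriv).add
      (IsH1.integrableOn_potential_mul hv.memLp hχ.memLp (continuous_realPotential p)
        (abs_realPotential_le hp))
  have i2 := IsH1.integrableOn_mul hv.memLp (isH1_soliton hp).memLp
  rw [schrodingerBilin, eq_neg_iff_add_eq_zero, ← integral_add i1 i2]
  refine Eq.trans ?_ h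
  congr 1; ext x; ring

/-- Since $\chi=\frac1{2p}\varphi+\frac12x\varphi'$, it suffices that $\int
x\varphi\varphi'=-\frac12\int\varphi^2$, which holds because $(x\varphi\cdot\varphi)'$ integrates to
zero. -/
theorem integral_scalingGenerator_mul_soliton (hp : 0 < p) :
    ∫ x in Ioi (0 : ℝ), scalingGenerator p x * soliton p x =
      (1 / (2 * p) - 1 / 4) * ∫ x in Ioi (0 : ℝ), soliton p x ^ 2 := by
  have hφ := isH1_soliton hp
  have hc := continuous_soliton hp
  have hc' := continuous_deriv_soliton hp
  have hx : IsH1 (fun x => x * soliton p x) (fun x => soliton p x + x * deriv (soliton p) x) := by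
    refine .of_hasDerivAt (fun x => ?_) (by fun_prop)
      (memLp_of_le_mul_soliton hp (by fun_prop) (C := 1) fun x hx => ?_)
      (memLp_of_le_mul_soliton hp (by fun_prop) (C := 1) fun x hx => ?_)
    · convert! (hasDerivAt_id x).mul
        (hasDerivAt_soliton hp x).differentiableAt.hasDerivAt using 1
      simp
    · rw [abs_mul, abs_of_pos hx, abs_of_pos (soliton_pos p x)]
      nlinarith [soliton_pos p x]
    · rw [deriv_soliton hp]
      have hs := soliton_pos p x
      have h0 := tanh_mul_pos hp hx
      have h1 := (abs_lt.1 (Real.abs_tanh_lt_one (p * x))).2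
      have hxt : x * Real.tanh (p * x) ≤ x := by nlinarith
      have hxt0 : 0 < x * Real.tanh (p * x) := by positivity
      have e : soliton p x + x * -(soliton p x * Real.tanh (p * x)) =
          (1 - x * Real.tanh (p * x)) * soliton p x := by ring
      rw [e, abs_mul, abs_of_pos hs]
      gcongr
      rw [abs_le]
      constructor <;> linarith
  have h := hx.integral_deriv_mul_add hφ
  rw [zero_mul, zero_mul, neg_zero] at h
  have i1 := IsH1.integrableOn_sq hφ.memLp
  have i2 : IntegrableOn (fun x => (soliton p x + x * deriv (soliton p) x) * soliton p x +
      x * soliton p x * deriv (soliton p) x) (Ioi 0) :=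
    (IsH1.integrableOn_mul hx.memLp_deriv hφ.memLp).add
      (IsH1.integrableOn_mul hx.memLp hφ.memLp_deriv)
  have e : (fun x => scalingGenerator p x * soliton p x) = fun x =>
      (1 / (2 * p) - 1 / 4) * soliton p x ^ 2 + 1 / 4 * ((soliton p x + x * deriv (soliton p) x) *
        soliton p x + x * soliton p x * deriv (soliton p) x) := by
    funext x
    simp only [scalingGenerator, deriv_soliton hp]
    ring
  rw [e, integral_add (i1.const_mul _) (i2.const_mul _), integral_const_mul, integral_const_mul, h,
    mul_zero, add_zero]

/-- Subcriticality enters here: $\frac14<\frac1{2p}$ exactly when $p<2$. The integral is half the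
$\omega$-derivative of the mass $\int\varphi_\omega^2$ at $\omega=1$. -/
theorem integral_scalingGenerator_mul_soliton_pos (hp : 0 < p) (hp2 : p < 2) :
    0 < ∫ x in Ioi (0 : ℝ), scalingGenerator p x * soliton p x := by
  rw [integral_scalingGenerator_mul_soliton hp]
  have h1 : 1 / 4 < 1 / (2 * p) := by
    apply one_div_lt_one_div_of_lt <;> linarith
  refine mul_pos (by linarith) ?_
  rw [setIntegral_pos_iff_support_of_nonneg_ae (ae_of_all _ fun x => sq_nonneg _)
    (IsH1.integrableOn_sq (isH1_soliton hp).memLp)]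
  have : Function.support (fun x => soliton p x ^ 2) = univ := by
    ext x; simp [(soliton_pos p x).ne']
  simp [this]

end ScalingGenerator

/-! ### Coupling the edges through the vertex and the constraint. -/

section Graph

variable {p : ℝ} {ι : Type*} [Fintype ι] {v g : ι → ℝ → ℝ}

/-- Every edge carries a multiple of $\varphi$; the common vertex value makes all multiples equal to
$a$, and the constraint becomes $|\iota|\,a\int\varphi^2=0$. -/
theorem sum_imagForm_eq_zero (hp : 0 < p) [Nonempty ι] (hv : ∀ j, IsH1 (v j) (g j)) {a : ℝ}
    (ha : ∀ j, v j 0 = a) (ho : ∑ j, ∫ x in Ioi (0 : ℝ), v j x * soliton p x = 0)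
    (hz : ∑ j, schrodingerForm (imagPotential p) (v j) (g j) = 0) :
    ∀ j x, 0 < x → v j x = 0 := by
  rw [Finset.sum_eq_zero_iff_of_nonneg fun j _ => (imagForm_nonneg hp (hv j)).1] at hz
  have h : ∀ j x, 0 < x → v j x = a * soliton p x := by
    intro j
    obtain ⟨c, hc⟩ := (imagForm_nonneg hp (hv j)).2 (hz j (Finset.mem_univ j))
    have h1 : Tendsto (v j) (𝓝[>] 0) (𝓝 a) := by
      rw [← ha j]
      exact ((hv j).continuousOn 0 self_mem_Ici).tendsto.mono_left
        (nhdsWithin_mono _ Ioi_subset_Ici_self)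
    have h2 : Tendsto (fun x => c * soliton p x) (𝓝[>] 0) (𝓝 (c * soliton p 0)) :=
      ((continuous_soliton hp).const_mul c).continuousAt.tendsto.mono_left nhdsWithin_le_nhds
    have : a = c := by
      rw [soliton_zero, mul_one] at h2
      refine tendsto_nhds_unique (h1.congr' ?_) h2
      filter_upwards [self_mem_nhdsWithin] with x hx using hc x hx
    rwa [this]
  have e : ∀ j, ∫ x in Ioi (0 : ℝ), v j x * soliton p x =
      a * ∫ x in Ioi (0 : ℝ), soliton p x ^ 2 := by
    intro j
    rw [← integral_const_mul]
    refine setIntegral_congr_fun measurableSet_Ioi fun x hx => ?_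
    simp only [h j x hx]
    ring
  have hpos : 0 < ∫ x in Ioi (0 : ℝ), soliton p x ^ 2 := by
    rw [setIntegral_pos_iff_support_of_nonneg_ae (ae_of_all _ fun x => sq_nonneg _)
      (IsH1.integrableOn_sq (isH1_soliton hp).memLp)]
    have : Function.support (fun x => soliton p x ^ 2) = univ := by
      ext x; simp [(soliton_pos p x).ne']
    simp [this]
  simp only [e, Finset.sum_const, nsmul_eq_mul] at ho
  have hcard : ((Finset.univ : Finset ι).card : ℝ) ≠ 0 := by simp
  have : a = 0 := by
    rcases mul_eq_zero.1 ho with h' | h'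
    · exact absurd h' hcard
    · exact (mul_eq_zero.1 h').resolve_right hpos.ne'
  intro j x hx
  rw [h j x hx, this, zero_mul]

/-- Expansion of the form at $v_j-b\chi$. The cross term is $2b\int v_j\varphi$, which the
constraint kills only after summation over the edges, and the form at $\chi$ is $-\int\chi\varphi$.
-/
theorem sum_realForm_eq (hp : 0 < p) (hv : ∀ j, IsH1 (v j) (g j))
    (ho : ∑ j, ∫ x in Ioi (0 : ℝ), v j x * soliton p x = 0) (b : ℝ) :
    ∑ j, schrodingerForm (realPotential p) (v j) (g j) =
      ∑ j, schrodingerForm (realPotential p) (fun x => v j x + -b * scalingGenerator p x)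
        (fun x => g j x + -b * scalingGeneratorDeriv p x) +
      Fintype.card ι * (b ^ 2 * ∫ x in Ioi (0 : ℝ), scalingGenerator p x * soliton p x) := by
  have hχ := isH1_scalingGenerator hp
  have e : schrodingerForm (realPotential p) (scalingGenerator p) (scalingGeneratorDeriv p) =
      -∫ x in Ioi (0 : ℝ), scalingGenerator p x * soliton p x := by
    rw [← schrodingerBilin_scalingGenerator hp hχ]
    unfold schrodingerForm schrodingerBilin
    congr 1; ext x; ring
  simp only [fun j => schrodingerForm_add_const_mul (continuous_realPotential p)
    (abs_realPotential_le hp) (hv j) hχ (-b), Finset.sum_add_distrib, ← Finset.mul_sum,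
    fun j => schrodingerBilin_scalingGenerator hp (hv j), e, Finset.sum_neg_distrib, ho]
  simp
  ring

theorem sum_realForm_nonneg (hp : 0 < p) (hp2 : p < 2) [Nonempty ι] (hv : ∀ j, IsH1 (v j) (g j))
    {a : ℝ} (ha : ∀ j, v j 0 = a) (ho : ∑ j, ∫ x in Ioi (0 : ℝ), v j x * soliton p x = 0) :
    0 ≤ ∑ j, schrodingerForm (realPotential p) (v j) (g j) ∧
      (∑ j, schrodingerForm (realPotential p) (v j) (g j) = 0 →
        ∃ c : ι → ℝ, ∀ j x, 0 < x → v j x = c j * deriv (soliton p) x) := by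
  have hχ := isH1_scalingGenerator hp
  have hpos := integral_scalingGenerator_mul_soliton_pos hp hp2
  -- The choice $b=2pa$ cancels the vertex value, since $\chi(0)=1/(2p)$.
  have hw : ∀ j, IsH1 (fun x => v j x + -(2 * p * a) * scalingGenerator p x)
      (fun x => g j x + -(2 * p * a) * scalingGeneratorDeriv p x) := fun j =>
    (hv j).add (hχ.const_mul _)
  have hw0 : ∀ j, v j 0 + -(2 * p * a) * scalingGenerator p 0 = 0 := fun j => by
    rw [ha, scalingGenerator_zero]
    field_simp
    ring
  have hn := fun j => realForm_nonneg hp (hw j) (hw0 j)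
  have hcard : (0 : ℝ) < Fintype.card ι := by exact_mod_cast Fintype.card_pos
  have hsum := Finset.sum_nonneg fun j (_ : j ∈ Finset.univ) => (hn j).1
  rw [sum_realForm_eq hp hv ho (2 * p * a)]
  refine ⟨by positivity, fun hz => ?_⟩
  have hlast : 0 ≤ (Fintype.card ι : ℝ) * ((2 * p * a) ^ 2 *
      ∫ x in Ioi (0 : ℝ), scalingGenerator p x * soliton p x) := by positivity
  have z1 := (add_eq_zero_iff_of_nonneg hsum hlast).1 hz
  -- A null vector makes the gain term vanish, so no multiple of $\chi$ was subtracted.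
  have hb : 2 * p * a = 0 := by
    have := (mul_eq_zero.1 z1.2).resolve_left hcard.ne'
    exact pow_eq_zero_iff (two_ne_zero) |>.1 ((mul_eq_zero.1 this).resolve_right hpos.ne')
  have hz' := z1.1
  rw [Finset.sum_eq_zero_iff_of_nonneg fun j _ => (hn j).1] at hz'
  choose c hc using fun j => (hn j).2 (hz' j (Finset.mem_univ j))
  refine ⟨c, fun j x hx => ?_⟩
  rw [← hc j x hx, hb]
  ring

end Graph

/-! ### Two real derivatives of $z\mapsto|z|^{2p+2}$. -/

section NormPow

/-- The vector field `z ↦ q |z|^{q-2} z`, with `q = 2p + 2`. -/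
def powField (p : ℝ) (z : ℂ) : ℂ := ((2 * p + 2) * ‖z‖ ^ (2 * p)) • z

/-- The derivative of `powField`. -/
def powFieldDeriv (p : ℝ) (z : ℂ) : ℂ →L[ℝ] ℂ :=
  (2 * p + 2) • (‖z‖ ^ (2 * p) • ContinuousLinearMap.id ℝ ℂ +
    (2 * p * ‖z‖ ^ (2 * p - 2)) • (innerSL ℝ z).smulRight z)

variable {p : ℝ}

theorem hasFDerivAt_norm_rpow_powField (hp : 0 < p) (z : ℂ) :
    HasFDerivAt (fun z : ℂ => ‖z‖ ^ (2 * p + 2)) (innerSL ℝ (powField p z)) z := by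
  have h := hasFDerivAt_norm_rpow z (p := 2 * p + 2) (by linarith)
  rw [show 2 * p + 2 - 2 = 2 * p by ring] at h
  rw [powField, map_smul]
  exact h

theorem hasFDerivAt_powField (hp : 0 < p) (z : ℂ) :
    HasFDerivAt (powField p) (powFieldDeriv p z) z := by
  rcases eq_or_ne z 0 with rfl | hz
  -- At the origin the field is $o(|z|)$ because $2p>0$, and the rank-one term vanishes whatever
  -- value the power $\|0\|^{2p-2}$ takes.
  · have e : powFieldDeriv p 0 = 0 := by
      ext h
      simp [powFieldDeriv, Real.zero_rpow (by positivity : 2 * p ≠ 0)]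
    rw [e, hasFDerivAt_iff_isLittleO_nhds_zero]
    have h1 : (fun z : ℂ => (2 * p + 2) * ‖z‖ ^ (2 * p)) =o[𝓝 0] fun _ => (1 : ℝ) := by
      rw [Asymptotics.isLittleO_one_iff]
      have : ContinuousAt (fun z : ℂ => (2 * p + 2) * ‖z‖ ^ (2 * p)) 0 :=
        (continuousAt_const).mul (continuous_norm.continuousAt.rpow_const (Or.inr (by positivity)))
      have h := this.tendsto
      simpa [Real.zero_rpow (by positivity : 2 * p ≠ 0)] using h
    have h2 := h1.smul_isBigO (Asymptotics.isBigO_refl (fun z : ℂ => z) (𝓝 0))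
    simpa [powField] using h2
  · have hn : ‖z‖ ≠ 0 := norm_ne_zero_iff.2 hz
    have h1 : HasFDerivAt (fun w : ℂ => ‖w‖ ^ (2 * p)) ((2 * p * ‖z‖ ^ (2 * p - 2)) • innerSL ℝ z)
        z := by
      have h := (hasStrictFDerivAt_norm_sq z).hasFDerivAt.rpow_const (p := p)
        (Or.inl (pow_ne_zero 2 hn))
      convert! h using 1
      · funext w
        rw [← Real.rpow_natCast, ← Real.rpow_mul (norm_nonneg _)]
        norm_num
      · rw [← Real.rpow_natCast, ← Real.rpow_mul (norm_nonneg _)]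
        rw [← Nat.cast_smul_eq_nsmul ℝ, smul_smul]
        congr 1
        push_cast
        rw [show (2 : ℝ) * (p - 1) = 2 * p - 2 by ring]
        ring
    have h2 := (h1.smul (hasFDerivAt_id z)).const_smul (2 * p + 2)
    convert! h2 using 1
    · funext w
      simp [powField, mul_smul]
    · ext w
      simp [powFieldDeriv, mul_assoc]

/-- For $p<1$ the factor $|w|^{2p-2}$ blows up at the origin, but the rank-one operator has norm
$|w|^2$, so the product is of size $|w|^{2p}$. -/
theorem continuous_powFieldDeriv (hp : 0 < p) : Continuous (powFieldDeriv p) := by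
  rw [continuous_iff_continuousAt]
  intro z
  have c1 : Continuous fun w : ℂ => ‖w‖ ^ (2 * p) :=
    continuous_norm.rpow_const fun _ => Or.inr (by positivity)
  have c2 : Continuous fun w : ℂ => (innerSL ℝ w).smulRight w :=
    (ContinuousLinearMap.smulRightL ℝ ℂ ℂ).continuous₂.comp
      (((innerSL ℝ).continuous).prodMk continuous_id)
  have key : ContinuousAt (fun w : ℂ => (2 * p * ‖w‖ ^ (2 * p - 2)) •
      (innerSL ℝ w).smulRight w) z := by
    rcases eq_or_ne z 0 with rfl | hz
    · have h0 : (2 * p * ‖(0 : ℂ)‖ ^ (2 * p - 2)) • (innerSL ℝ (0 : ℂ)).smulRight (0 : ℂ) = 0 := by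
        simp
      rw [ContinuousAt, h0]
      have h1 := (c1.const_mul (2 * p)).tendsto 0
      simp only [norm_zero, Real.zero_rpow (by positivity : 2 * p ≠ 0), mul_zero] at h1
      refine squeeze_zero_norm (fun w => ?_) h1
      rcases eq_or_ne w 0 with rfl | hw
      · rw [h0]; simp [Real.zero_rpow (by positivity : 2 * p ≠ 0)]
      · have hn : 0 < ‖w‖ := norm_pos_iff.2 hw
        rw [norm_smul, ContinuousLinearMap.norm_smulRight_apply, innerSL_apply_norm,
          Real.norm_of_nonneg (by positivity), Real.rpow_sub hn, Real.rpow_two]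
        apply le_of_eq
        field_simp
    · have h : ContinuousAt (fun w : ℂ => ‖w‖ ^ (2 * p - 2)) z :=
        continuous_norm.continuousAt.rpow_const (Or.inl (norm_ne_zero_iff.2 hz))
      exact (h.const_mul (2 * p)).smul c2.continuousAt
  have key' : ContinuousAt (fun w : ℂ => ‖w‖ ^ (2 * p) • ContinuousLinearMap.id ℝ ℂ) z :=
    c1.continuousAt.smul continuousAt_const
  exact (key'.add key).const_smul (2 * p + 2)

/-- At a positive real point the rank-one part acts only on the real direction; this is the source
of the decoupling and of the factor $2p+1$. -/
theorem powFieldDeriv_ofReal {r : ℝ} (hr : 0 < r) (w : ℂ) :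
    powFieldDeriv p (r : ℂ) w =
      ⟨(2 * p + 2) * r ^ (2 * p) * ((2 * p + 1) * w.re), (2 * p + 2) * r ^ (2 * p) * w.im⟩ := by
  have e : r ^ (2 * p - 2) * r ^ 2 = r ^ (2 * p) := by
    rw [← Real.rpow_two, ← Real.rpow_add hr]; ring_nf
  apply Complex.ext
  · simp [powFieldDeriv, Complex.inner, abs_of_pos hr]
    linear_combination (2 * p + 2) * 2 * p * w.re * e
  · simp [powFieldDeriv, Complex.inner, abs_of_pos hr]
    ring

end NormPow

/-! ### Differentiability of superposition operators and integral functionals. -/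

section Superposition

/-- `G : ℂ → ℂ` is a `C¹` vector field vanishing at the origin, with derivative `dG`. -/
structure IsC1Field (G : ℂ → ℂ) (dG : ℂ → ℂ →L[ℝ] ℂ) : Prop where
  hasFDerivAt : ∀ z, HasFDerivAt G (dG z) z
  continuous_deriv : Continuous dG
  map_zero : G 0 = 0

theorem isC1Field_powField {p : ℝ} (hp : 0 < p) : IsC1Field (powField p) (powFieldDeriv p) :=
  ⟨hasFDerivAt_powField hp, continuous_powFieldDeriv hp, by simp [powField]⟩

namespace IsC1Field

variable {G : ℂ → ℂ} {dG : ℂ → ℂ →L[ℝ] ℂ}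

theorem continuous (hG : IsC1Field G dG) : Continuous G :=
  continuous_iff_continuousAt.2 fun z => (hG.hasFDerivAt z).continuousAt

theorem exists_bound (hG : IsC1Field G dG) (R : ℝ) :
    ∃ C, 0 ≤ C ∧ ∀ z : ℂ, ‖z‖ ≤ R → ‖dG z‖ ≤ C := by
  obtain ⟨C, hC⟩ := (isCompact_closedBall (0 : ℂ) R).exists_bound_of_continuousOn
    hG.continuous_deriv.continuousOn
  exact ⟨max C 0, le_max_right _ _, fun z hz => (hC z (by simpa using hz)).trans (le_max_left _ _)⟩

theorem norm_sub_le (hG : IsC1Field G dG) {R C : ℝ} (hC : ∀ z : ℂ, ‖z‖ ≤ R → ‖dG z‖ ≤ C) {z w : ℂ}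
    (hz : ‖z‖ ≤ R) (hw : ‖w‖ ≤ R) : ‖G w - G z‖ ≤ C * ‖w - z‖ :=
  (convex_closedBall (0 : ℂ) R).norm_image_sub_le_of_norm_hasFDerivWithin_le
    (fun x _ => (hG.hasFDerivAt x).hasFDerivWithinAt) (fun x hx => hC x (by simpa using hx))
    (by simpa using hz) (by simpa using hw)

theorem norm_le (hG : IsC1Field G dG) {R C : ℝ} (hC : ∀ z : ℂ, ‖z‖ ≤ R → ‖dG z‖ ≤ C) {z : ℂ}
    (hz : ‖z‖ ≤ R) : ‖G z‖ ≤ C * ‖z‖ := by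
  have := hG.norm_sub_le hC (z := 0) (w := z) (by simpa using (norm_nonneg z).trans hz) hz
  simpa [hG.map_zero] using this

/-- Uniform continuity of `dG` on a ball makes the remainder uniform in the base point, so the
estimate can be used almost everywhere at once. -/
theorem exists_delta (hG : IsC1Field G dG) (R : ℝ) {ε : ℝ} (hε : 0 < ε) :
    ∃ δ, 0 < δ ∧ ∀ z h : ℂ, ‖z‖ ≤ R → ‖z + h‖ ≤ R → ‖h‖ ≤ δ →
      ‖G (z + h) - G z - dG z h‖ ≤ ε * ‖h‖ := by
  have hu := (isCompact_closedBall (0 : ℂ) R).uniformContinuousOn_of_continuous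
    hG.continuous_deriv.continuousOn
  obtain ⟨δ, hδ, h⟩ := Metric.uniformContinuousOn_iff.1 hu ε hε
  refine ⟨δ / 2, by positivity, fun z w hz hzw hw => ?_⟩
  have key := (((convex_closedBall (0 : ℂ) R).inter
    (convex_closedBall z (δ / 2)))).norm_image_sub_le_of_norm_hasFDerivWithin_le' (f := G)
    (f' := dG) (φ := dG z) (C := ε) (x := z) (y := z + w)
    (fun x _ => (hG.hasFDerivAt x).hasFDerivWithinAt) (fun x hx => ?_)
    ⟨by simpa using hz, by simp; positivity⟩ ⟨by simpa using hzw, by simpa using hw⟩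
  · simpa using key
  · rw [← dist_eq_norm]
    exact (h x hx.1 z (by simpa using hz) (lt_of_le_of_lt hx.2 (by linarith))).le

variable {F : ℂ → ℝ}

/-- On the ball the gradient `G` is `C`-Lipschitz, so it varies by at most $C\|h\|$ along the
segment from $z$ to $z+h$. -/
theorem abs_sub_sub_inner_le (hG : IsC1Field G dG)
    (hF : ∀ z, HasFDerivAt F (innerSL ℝ (G z)) z) {R C : ℝ} (hC0 : 0 ≤ C)
    (hC : ∀ z : ℂ, ‖z‖ ≤ R → ‖dG z‖ ≤ C) {z h : ℂ} (hz : ‖z‖ ≤ R) (hzh : ‖z + h‖ ≤ R) :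
    |F (z + h) - F z - inner ℝ (G z) h| ≤ C * ‖h‖ ^ 2 := by
  have key := (((convex_closedBall (0 : ℂ) R).inter
    (convex_closedBall z ‖h‖))).norm_image_sub_le_of_norm_hasFDerivWithin_le' (f := F)
    (f' := fun z => innerSL ℝ (G z)) (φ := innerSL ℝ (G z)) (C := C * ‖h‖) (x := z) (y := z + h)
    (fun x _ => (hF x).hasFDerivWithinAt) (fun x hx => ?_)
    ⟨by simpa using hz, by simp⟩ ⟨by simpa using hzh, by simp⟩
  · rw [add_sub_cancel_left, innerSL_apply_apply, Real.norm_eq_abs] at key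
    exact key.trans (le_of_eq (by ring))
  · rw [← map_sub, innerSL_apply_norm]
    refine (hG.norm_sub_le hC hz (by simpa using hx.1)).trans ?_
    gcongr
    rw [← dist_eq_norm]
    exact hx.2

theorem memLp_comp (hG : IsC1Field G dG) (f : L2) {R : ℝ} (hR : ∀ᵐ y ∂edgeMeasure, ‖f y‖ ≤ R) :
    MemLp (fun y => G (f y)) 2 edgeMeasure := by
  obtain ⟨C, -, hC⟩ := hG.exists_bound R
  refine MemLp.of_le_mul (c := C) (Lp.memLp f)
    (hG.continuous.comp_aestronglyMeasurable (Lp.aestronglyMeasurable f)) ?_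
  filter_upwards [hR] with y hy using hG.norm_le hC hy

theorem memLp_deriv_apply (hG : IsC1Field G dG) (f h : L2) {R : ℝ}
    (hR : ∀ᵐ y ∂edgeMeasure, ‖f y‖ ≤ R) :
    MemLp (fun y => dG (f y) (h y)) 2 edgeMeasure := by
  obtain ⟨C, -, hC⟩ := hG.exists_bound R
  refine MemLp.of_le_mul (c := C) (Lp.memLp h) ?_ ?_
  · exact (isBoundedBilinearMap_apply (𝕜 := ℝ) (E := ℂ)
      (F := ℂ)).continuous.comp_aestronglyMeasurable ((hG.continuous_deriv.comp_aestronglyMeasurable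
        (Lp.aestronglyMeasurable f)).prodMk
        (Lp.aestronglyMeasurable h))
  · filter_upwards [hR] with y hy
    exact ((dG (f y)).le_opNorm _).trans (by gcongr; exact hC _ hy)

theorem exists_derivCLM (hG : IsC1Field G dG) (f : L2) {R : ℝ}
    (hR : ∀ᵐ y ∂edgeMeasure, ‖f y‖ ≤ R) :
    ∃ D : L2 →L[ℝ] L2, ∀ h, D h =ᵐ[edgeMeasure] fun y => dG (f y) (h y) := by
  obtain ⟨C, hC0, hC⟩ := hG.exists_bound R
  let D : L2 →ₗ[ℝ] L2 :=
    { toFun := fun h => (hG.memLp_deriv_apply f h hR).toLp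
      map_add' := fun h k => by
        apply Lp.ext
        filter_upwards [(hG.memLp_deriv_apply f (h + k) hR).coeFn_toLp,
          (hG.memLp_deriv_apply f h hR).coeFn_toLp, (hG.memLp_deriv_apply f k hR).coeFn_toLp,
          Lp.coeFn_add h k, Lp.coeFn_add (hG.memLp_deriv_apply f h hR).toLp
            (hG.memLp_deriv_apply f k hR).toLp] with y e1 e2 e3 e4 e5
        rw [e1, e5, Pi.add_apply, e2, e3, e4, Pi.add_apply, map_add]
      map_smul' := fun c h => by
        apply Lp.ext
        filter_upwards [(hG.memLp_deriv_apply f (c • h) hR).coeFn_toLp,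
          (hG.memLp_deriv_apply f h hR).coeFn_toLp,
          Lp.coeFn_smul c h, Lp.coeFn_smul c (hG.memLp_deriv_apply f h hR).toLp]
          with y e1 e2 e3 e4
        rw [e1, RingHom.id_apply, e4, Pi.smul_apply, e2, e3, Pi.smul_apply, map_smul] }
  refine ⟨D.mkContinuous C fun h => ?_, fun h => (hG.memLp_deriv_apply f h hR).coeFn_toLp⟩
  refine Lp.norm_le_mul_norm_of_ae_le_mul ?_
  filter_upwards [(hG.memLp_deriv_apply f h hR).coeFn_toLp, hR] with y e1 hy
  change ‖(hG.memLp_deriv_apply f h hR).toLp _ y‖ ≤ _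
  rw [e1]
  exact ((dG (f y)).le_opNorm _).trans (by gcongr; exact hC _ hy)

variable {X : Type*} [NormedAddCommGroup X] [NormedSpace ℝ X] {T : X →L[ℝ] L2} {K : ℝ}

theorem ae_bound_of_norm_le (hK : 0 ≤ K) (hT : ∀ x, ∀ᵐ y ∂edgeMeasure, ‖T x y‖ ≤ K * ‖x‖) {x : X}
    {r : ℝ} (hx : ‖x‖ ≤ r) : ∀ᵐ y ∂edgeMeasure, ‖T x y‖ ≤ K * r := by
  filter_upwards [hT x] with y hy using hy.trans (by gcongr)

/-- The superposition operator `x ↦ G ∘ T x` into `L²`. -/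
def superposition (hG : IsC1Field G dG) (hT : ∀ x, ∀ᵐ y ∂edgeMeasure, ‖T x y‖ ≤ K * ‖x‖) (x : X) :
    L2 := (hG.memLp_comp (T x) (hT x)).toLp

theorem coeFn_superposition (hG : IsC1Field G dG)
    (hT : ∀ x, ∀ᵐ y ∂edgeMeasure, ‖T x y‖ ≤ K * ‖x‖) (x : X) :
    superposition hG hT x =ᵐ[edgeMeasure] fun y => G (T x y) :=
  (hG.memLp_comp (T x) (hT x)).coeFn_toLp

/-- On $L^2$ alone superposition is in general not Fréchet differentiable. The bound of `T x` in
$L^\infty$ makes `T h` uniformly small for small `h`, so the pointwise Taylor estimate holds almost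
everywhere. -/
theorem hasFDerivAt_superposition (hG : IsC1Field G dG) (hK : 0 ≤ K)
    (hT : ∀ x, ∀ᵐ y ∂edgeMeasure, ‖T x y‖ ≤ K * ‖x‖) (x : X) :
    ∃ D : X →L[ℝ] L2, HasFDerivAt (superposition hG hT) D x ∧
      ∀ h, D h =ᵐ[edgeMeasure] fun y => dG (T x y) (T h y) := by
  obtain ⟨D, hD⟩ := hG.exists_derivCLM (T x) (hT x)
  refine ⟨D.comp T, ?_, fun h => hD (T h)⟩
  rw [hasFDerivAt_iff_isLittleO_nhds_zero, Asymptotics.isLittleO_iff]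
  intro ε hε
  -- The radius covers `T x` and `T (x + h)` for $\|h\|\le1$; the divisor $\|T\|+1$ absorbs the norm
  -- of `T` and avoids division by zero.
  obtain ⟨δ, hδ, hδ'⟩ := hG.exists_delta (K * (‖x‖ + 1)) (ε := ε / (‖T‖ + 1)) (by positivity)
  have hnear : ∀ᶠ h : X in 𝓝 0, ‖h‖ ≤ min 1 (δ / (K + 1)) := by
    have : Metric.closedBall (0 : X) (min 1 (δ / (K + 1))) ∈ 𝓝 0 :=
      Metric.closedBall_mem_nhds _ (by positivity)
    filter_upwards [this] with h hh
    simpa using hh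
  filter_upwards [hnear] with h hh
  have hh1 : ‖h‖ ≤ 1 := hh.trans (min_le_left _ _)
  have hh2 : K * ‖h‖ ≤ δ := by
    have h1 := hh.trans (min_le_right _ _)
    rw [le_div_iff₀ (by positivity)] at h1
    nlinarith [norm_nonneg h]
  have main : ‖superposition hG hT (x + h) - superposition hG hT x - (D.comp T) h‖ ≤
      ε / (‖T‖ + 1) * ‖T h‖ := by
    refine Lp.norm_le_mul_norm_of_ae_le_mul ?_
    filter_upwards [coeFn_superposition hG hT (x + h), coeFn_superposition hG hT x, hD (T h),
      Lp.coeFn_sub (superposition hG hT (x + h) - superposition hG hT x) ((D.comp T) h),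
      Lp.coeFn_sub (superposition hG hT (x + h)) (superposition hG hT x),
      Lp.coeFn_add (T x) (T h), ae_bound_of_norm_le hK hT (x := x) (r := ‖x‖ + 1) (by linarith),
      ae_bound_of_norm_le hK hT (x := x + h) (r := ‖x‖ + 1)
        ((norm_add_le _ _).trans (by linarith)), hT h] with y e1 e2 e3 e4 e5 e6 b1 b2 b3
    rw [map_add, e6, Pi.add_apply] at b2
    rw [e4, Pi.sub_apply, e5, Pi.sub_apply, e1, e2, ContinuousLinearMap.comp_apply, e3, map_add,
      e6, Pi.add_apply]
    exact hδ' _ _ b1 b2 (b3.trans hh2)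
  refine main.trans ?_
  calc ε / (‖T‖ + 1) * ‖T h‖ ≤ ε / (‖T‖ + 1) * (‖T‖ * ‖h‖) := by
        gcongr; exact T.le_opNorm h
    _ = ε * ‖h‖ * (‖T‖ / (‖T‖ + 1)) := by ring
    _ ≤ ε * ‖h‖ * 1 := by
        gcongr
        rw [div_le_one (by positivity)]
        linarith
    _ = _ := mul_one _

theorem integral_norm_sq (f : L2) : ∫ y in Ioi (0 : ℝ), ‖f y‖ ^ 2 = ‖f‖ ^ 2 := by
  rw [← real_inner_self_eq_norm_sq, L2.inner_def]
  simp

theorem integrable_norm_sq (f : L2) : Integrable (fun y => ‖f y‖ ^ 2) edgeMeasure := by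
  have := L2.integrable_inner (𝕜 := ℝ) f f
  simpa using this

theorem integrable_potential (hG : IsC1Field G dG) (hF : ∀ z, HasFDerivAt F (innerSL ℝ (G z)) z)
    (hF0 : F 0 = 0) (f : L2) {R : ℝ} (hR : ∀ᵐ y ∂edgeMeasure, ‖f y‖ ≤ R) :
    Integrable (fun y => F (f y)) edgeMeasure := by
  obtain ⟨C, hC0, hC⟩ := hG.exists_bound R
  have hFc : Continuous F := continuous_iff_continuousAt.2 fun z => (hF z).continuousAt
  refine ((integrable_norm_sq f).const_mul C).mono'
    (hFc.comp_aestronglyMeasurable (Lp.aestronglyMeasurable f)) ?_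
  filter_upwards [hR] with y hy
  have := hG.abs_sub_sub_inner_le hF hC0 hC (z := 0) (h := f y)
    (by simpa using (norm_nonneg _).trans hy) (by simpa using hy)
  simpa [hF0, hG.map_zero] using this

/-- The pointwise remainder $C|Th|^2$ integrates to at most $C\|T\|^2\|h\|^2$. -/
theorem hasFDerivAt_integral (hG : IsC1Field G dG) (hF : ∀ z, HasFDerivAt F (innerSL ℝ (G z)) z)
    (hF0 : F 0 = 0) (hK : 0 ≤ K) (hT : ∀ x, ∀ᵐ y ∂edgeMeasure, ‖T x y‖ ≤ K * ‖x‖) (x : X) :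
    HasFDerivAt (fun x => ∫ y in Ioi (0 : ℝ), F (T x y))
      ((innerSL ℝ (superposition hG hT x)).comp T) x := by
  obtain ⟨C, hC0, hC⟩ := hG.exists_bound (K * (‖x‖ + 1))
  rw [hasFDerivAt_iff_isLittleO_nhds_zero]
  have hO : (fun h : X => (∫ y in Ioi (0 : ℝ), F (T (x + h) y)) - (∫ y in Ioi (0 : ℝ), F (T x y)) -
      ((innerSL ℝ (superposition hG hT x)).comp T) h) =O[𝓝 0] fun h => ‖h‖ ^ 2 := by
    refine Asymptotics.IsBigO.of_bound (C * ‖T‖ ^ 2) ?_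
    have : Metric.closedBall (0 : X) 1 ∈ 𝓝 0 := Metric.closedBall_mem_nhds _ one_pos
    filter_upwards [this] with h hh
    have hh1 : ‖h‖ ≤ 1 := by simpa using hh
    have i1 := hG.integrable_potential hF hF0 (T (x + h)) (hT (x + h))
    have i2 := hG.integrable_potential hF hF0 (T x) (hT x)
    have i3 := L2.integrable_inner (𝕜 := ℝ) (superposition hG hT x) (T h)
    rw [ContinuousLinearMap.comp_apply, innerSL_apply_apply, L2.inner_def, ← integral_sub i1 i2,
      ← integral_sub (by exact i1.sub i2) i3]
    calc _ ≤ ∫ y in Ioi (0 : ℝ), C * ‖T h y‖ ^ 2 := by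
          refine norm_integral_le_of_norm_le ((integrable_norm_sq (T h)).const_mul C) ?_
          filter_upwards [coeFn_superposition hG hT x, Lp.coeFn_add (T x) (T h),
            ae_bound_of_norm_le hK hT (x := x) (r := ‖x‖ + 1) (by linarith),
            ae_bound_of_norm_le hK hT (x := x + h) (r := ‖x‖ + 1)
              ((norm_add_le _ _).trans (by linarith))] with y e1 e2 b1 b2
          rw [map_add, e2, Pi.add_apply] at b2
          rw [e1, map_add, e2, Pi.add_apply]
          exact hG.abs_sub_sub_inner_le hF hC0 hC b1 b2
      _ = C * ‖T h‖ ^ 2 := by rw [integral_const_mul, integral_norm_sq]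
      _ ≤ C * (‖T‖ * ‖h‖) ^ 2 := by gcongr; exact T.le_opNorm h
      _ = _ := by rw [Real.norm_of_nonneg (sq_nonneg _)]; ring
  refine hO.trans_isLittleO ?_
  have : (fun h : X => ‖h‖ ^ 2) =o[𝓝 0] fun h => ‖h‖ := by
    have h1 : (fun h : X => ‖h‖) =o[𝓝 0] fun _ => (1 : ℝ) := by
      rw [Asymptotics.isLittleO_one_iff]
      exact tendsto_norm_zero
    simpa [pow_two] using h1.mul_isBigO (Asymptotics.isBigO_refl (fun h : X => ‖h‖) (𝓝 0))
  exact this.of_norm_right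

end IsC1Field

end Superposition

/-! ### Fréchet derivatives of the action and the formula for the second variation. -/

section GraphCalculus

/-- Functionals `∑ ‖D x‖² + ‖T x‖² - ∫ |T x|^{2p+2}` with `T` bounded into `L² ∩ L^∞` are
differentiable, and twice differentiable at every point. -/
theorem semilinear_calculus {X : Type*} [NormedAddCommGroup X] [NormedSpace ℝ X] {ι : Type*}
    [Fintype ι] {p : ℝ} (hp : 0 < p) (T D : ι → X →L[ℝ] L2)
    (hT : ∀ j x, ∀ᵐ y ∂edgeMeasure, ‖T j x y‖ ≤ 1 * ‖x‖) (A : X → ℝ)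
    (hA : ∀ x, A x = ∑ j, (‖D j x‖ ^ 2 + ‖T j x‖ ^ 2 -
      ∫ y in Ioi (0 : ℝ), ‖T j x y‖ ^ (2 * p + 2))) (x : X) :
    (∀ x, DifferentiableAt ℝ A x) ∧ DifferentiableAt ℝ (fderiv ℝ A) x ∧
    ∀ v w, fderiv ℝ (fderiv ℝ A) x v w =
      ∑ j, (2 * inner ℝ (D j v) (D j w) + 2 * inner ℝ (T j v) (T j w) -
        ∫ y in Ioi (0 : ℝ), inner ℝ (powFieldDeriv p (T j x y) (T j v y)) (T j w y)) := by
  have hG := isC1Field_powField hp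
  let g : ι → X → L2 := fun j => hG.superposition (hT j)
  let A' : X → X →L[ℝ] ℝ := fun x => ∑ j, ((2 : ℝ) • (innerSL ℝ (D j x)).comp (D j) +
    (2 : ℝ) • (innerSL ℝ (T j x)).comp (T j) - (innerSL ℝ (g j x)).comp (T j))
  have hA' : ∀ x, HasFDerivAt A (A' x) x := by
    intro x
    rw [show A = _ from funext hA]
    refine HasFDerivAt.fun_sum fun j _ => ?_
    have h0 : (fun z : ℂ => ‖z‖ ^ (2 * p + 2)) 0 = 0 := by
      simp [Real.zero_rpow (by positivity : 2 * p + 2 ≠ 0)]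
    have h3 := hG.hasFDerivAt_integral (hasFDerivAt_norm_rpow_powField hp) h0 zero_le_one (hT j) x
    have h1 := (D j).hasFDerivAt (x := x) |>.norm_sq
    have h2 := (T j).hasFDerivAt (x := x) |>.norm_sq
    convert! (h1.add h2).sub h3 using 1
    ext v
    simp [g]
  have hfd : fderiv ℝ A = A' := funext fun x => (hA' x).fderiv
  choose S hS hS' using fun j => hG.hasFDerivAt_superposition zero_le_one (hT j) x
  -- The map `B S` sends `u` to the functional $\langle u,S\,\cdot\rangle$. Through it the gradient
  -- is a continuous linear image of linear maps and superpositions, and the chain rule suffices.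
  let B : (X →L[ℝ] L2) → L2 →L[ℝ] (X →L[ℝ] ℝ) := fun S =>
    ((ContinuousLinearMap.compL ℝ X L2 ℝ).flip S).comp (innerSL ℝ)
  have hB : ∀ S u v, B S u v = inner ℝ u (S v) := fun S u v => rfl
  have hA'' : HasFDerivAt A' (∑ j, ((2 : ℝ) • (B (D j)).comp (D j) +
      (2 : ℝ) • (B (T j)).comp (T j) - (B (T j)).comp (S j))) x := by
    refine HasFDerivAt.fun_sum fun j _ => ?_
    have h1 := ((B (D j)).comp (D j)).hasFDerivAt (x := x)
    have h2 := ((B (T j)).comp (T j)).hasFDerivAt (x := x)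
    have h3 := (B (T j)).hasFDerivAt.comp x (hS j)
    exact ((h1.const_smul (2 : ℝ)).add (h2.const_smul (2 : ℝ))).sub h3
  refine ⟨fun x => (hA' x).differentiableAt, ?_, fun v w => ?_⟩
  · rw [hfd]; exact hA''.differentiableAt
  · rw [hfd, hA''.fderiv]
    simp only [sum_apply, sub_apply, add_apply, smul_apply, ContinuousLinearMap.comp_apply, hB,
      smul_eq_mul]
    refine Finset.sum_congr rfl fun j _ => ?_
    congr 1
    rw [L2.inner_def]
    refine integral_congr_ae ?_
    filter_upwards [hS' j v] with y h1
    rw [h1]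

variable {N : ℕ}

theorem norm_fst_sq_add_norm_snd_sq_le (Ψ : H1Vertex N) (j : Fin N) :
    ‖comp Ψ j‖ ^ 2 + ‖compDeriv Ψ j‖ ^ 2 ≤ ‖Ψ‖ ^ 2 := by
  have h1 : ‖Ψ.1 j‖ ≤ ‖Ψ‖ := PiLp.norm_apply_le Ψ.1 j
  have h2 : ‖Ψ.1 j‖ ^ 2 = ‖comp Ψ j‖ ^ 2 + ‖compDeriv Ψ j‖ ^ 2 :=
    WithLp.prod_norm_sq_eq_of_L2 (Ψ.1 j).1
  rw [← h2]
  gcongr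

/-- `Ψ ↦ ψ_j` as a continuous real linear map. -/
def compCLM (j : Fin N) : H1Vertex N →L[ℝ] L2 :=
  LinearMap.mkContinuous
    { toFun := fun Ψ => comp Ψ j
      map_add' := fun _ _ => rfl
      map_smul' := fun _ _ => rfl } 1 fun Ψ => by
    have h := norm_fst_sq_add_norm_snd_sq_le Ψ j
    have h' : ‖comp Ψ j‖ ^ 2 ≤ ‖Ψ‖ ^ 2 := by linarith [sq_nonneg ‖compDeriv Ψ j‖]
    rw [one_mul]
    exact abs_le_of_sq_le_sq' h' (norm_nonneg _) |>.2

/-- `Ψ ↦ ψ_j'` as a continuous real linear map. -/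
def compDerivCLM (j : Fin N) : H1Vertex N →L[ℝ] L2 :=
  LinearMap.mkContinuous
    { toFun := fun Ψ => compDeriv Ψ j
      map_add' := fun _ _ => rfl
      map_smul' := fun _ _ => rfl } 1 fun Ψ => by
    have h := norm_fst_sq_add_norm_snd_sq_le Ψ j
    have h' : ‖compDeriv Ψ j‖ ^ 2 ≤ ‖Ψ‖ ^ 2 := by linarith [sq_nonneg ‖comp Ψ j‖]
    rw [one_mul]
    exact abs_le_of_sq_le_sq' h' (norm_nonneg _) |>.2

@[simp] theorem compCLM_apply (j : Fin N) (Ψ : H1Vertex N) : compCLM j Ψ = comp Ψ j := rfl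

@[simp] theorem compDerivCLM_apply (j : Fin N) (Ψ : H1Vertex N) :
    compDerivCLM j Ψ = compDeriv Ψ j := rfl

theorem memLp_re (f : L2) : MemLp (fun x => (f x).re) 2 edgeMeasure := (Lp.memLp f).re

theorem memLp_im (f : L2) : MemLp (fun x => (f x).im) 2 edgeMeasure := (Lp.memLp f).im

theorem norm_sq_eq_integral_re_add_im (f : L2) :
    ‖f‖ ^ 2 = (∫ x in Ioi (0 : ℝ), (f x).re ^ 2) + ∫ x in Ioi (0 : ℝ), (f x).im ^ 2 := by
  rw [← IsC1Field.integral_norm_sq, ← integral_add (memLp_re f).integrable_sq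
    (memLp_im f).integrable_sq]
  congr 1; ext x
  rw [Complex.sq_norm, Complex.normSq_apply]
  ring

theorem exists_isH1_re (u : H1) : ∃ v, IsH1 v (fun x => (u.1.snd x).re) ∧
    (fun x => (u.1.fst x).re) =ᵐ[edgeMeasure] v := by
  refine exists_isH1_of_weakDeriv (memLp_re _) (memLp_re _) fun η h1 h2 h3 => ?_
  have h := congrArg Complex.re (u.2 η h1 h2 h3)
  rw [Complex.neg_re] at h
  have e : ∀ w : ℝ → ℝ, Continuous w → HasCompactSupport w → ∀ f : L2,
      (∫ x in Ioi (0 : ℝ), w x • f x).re = ∫ x in Ioi (0 : ℝ), w x * (f x).re := by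
    intro w hw hc f
    rw [← Complex.reCLM_apply, ← ContinuousLinearMap.integral_comp_comm _
      (integrable_smul_test hw hc f)]
    simp
  rwa [e _ (h1.continuous_deriv (by simp)) h2.deriv, e _ h1.continuous h2] at h

theorem exists_isH1_im (u : H1) : ∃ v, IsH1 v (fun x => (u.1.snd x).im) ∧
    (fun x => (u.1.fst x).im) =ᵐ[edgeMeasure] v := by
  refine exists_isH1_of_weakDeriv (memLp_im _) (memLp_im _) fun η h1 h2 h3 => ?_
  have h := congrArg Complex.im (u.2 η h1 h2 h3)
  rw [Complex.neg_im] at h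
  have e : ∀ w : ℝ → ℝ, Continuous w → HasCompactSupport w → ∀ f : L2,
      (∫ x in Ioi (0 : ℝ), w x • f x).im = ∫ x in Ioi (0 : ℝ), w x * (f x).im := by
    intro w hw hc f
    rw [← Complex.imCLM_apply, ← ContinuousLinearMap.integral_comp_comm _
      (integrable_smul_test hw hc f)]
    simp
  rwa [e _ (h1.continuous_deriv (by simp)) h2.deriv, e _ h1.continuous h2] at h

/-- The embedding is applied to real and imaginary parts separately; the squared bounds add up, so
the constant remains $1$. -/
theorem ae_norm_comp_le (j : Fin N) (Ψ : H1Vertex N) :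
    ∀ᵐ x ∂edgeMeasure, ‖compCLM j Ψ x‖ ≤ 1 * ‖Ψ‖ := by
  obtain ⟨v, hv, hv'⟩ := exists_isH1_re (Ψ.1 j)
  obtain ⟨w, hw, hw'⟩ := exists_isH1_im (Ψ.1 j)
  filter_upwards [hv', hw', ae_restrict_mem measurableSet_Ioi] with x h1 h2 hx
  have hx : 0 < x := hx
  have b1 := hv.sq_le hx.le
  have b2 := hw.sq_le hx.le
  have e1 : ∫ t in Ioi (0 : ℝ), v t ^ 2 = ∫ t in Ioi (0 : ℝ), (comp Ψ j t).re ^ 2 := by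
    refine integral_congr_ae ?_
    filter_upwards [hv'] with t ht
    rw [← ht]; rfl
  have e2 : ∫ t in Ioi (0 : ℝ), w t ^ 2 = ∫ t in Ioi (0 : ℝ), (comp Ψ j t).im ^ 2 := by
    refine integral_congr_ae ?_
    filter_upwards [hw'] with t ht
    rw [← ht]; rfl
  have b3 := norm_fst_sq_add_norm_snd_sq_le Ψ j
  rw [norm_sq_eq_integral_re_add_im, norm_sq_eq_integral_re_add_im (compDeriv Ψ j), ← e1, ← e2]
    at b3
  have e3 : ‖compCLM j Ψ x‖ ^ 2 = v x ^ 2 + w x ^ 2 := by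
    rw [← h1, ← h2, Complex.sq_norm, Complex.normSq_apply, compCLM_apply, comp]
    ring
  rw [one_mul]
  refine abs_le_of_sq_le_sq' ?_ (norm_nonneg _) |>.2
  rw [e3]
  refine le_trans ?_ b3
  refine (add_le_add b1 b2).trans (le_of_eq ?_)
  simp only [compDeriv]
  ring

variable {p : ℝ}

theorem action_eq (Ψ : H1Vertex N) : action N p Ψ =
    ∑ j, (‖compDerivCLM j Ψ‖ ^ 2 + ‖compCLM j Ψ‖ ^ 2 -
      ∫ x in Ioi (0 : ℝ), ‖compCLM j Ψ x‖ ^ (2 * p + 2)) := by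
  simp only [action, energy, mass, IsC1Field.integral_norm_sq, Finset.sum_sub_distrib,
    Finset.sum_add_distrib, compCLM_apply, compDerivCLM_apply]
  ring

theorem action_calculus (hp : 0 < p) :
    (∀ Ψ, DifferentiableAt ℝ (action N p) Ψ) ∧
    DifferentiableAt ℝ (fderiv ℝ (action N p)) (halfSoliton N p hp) ∧
    ∀ V W, fderiv ℝ (fderiv ℝ (action N p)) (halfSoliton N p hp) V W =
      ∑ j, (2 * inner ℝ (compDeriv V j) (compDeriv W j) + 2 * inner ℝ (comp V j) (comp W j) -
        ∫ x in Ioi (0 : ℝ),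
          inner ℝ (powFieldDeriv p (comp (halfSoliton N p hp) j x) (comp V j x)) (comp W j x)) := by
  let _ : NormedAddCommGroup (H1Vertex N) := Submodule.normedAddCommGroup _
  let _ : NormedSpace ℝ (H1Vertex N) := Submodule.normedSpace _
  exact semilinear_calculus (X := H1Vertex N) hp compCLM compDerivCLM ae_norm_comp_le (action N p)
    action_eq (halfSoliton N p hp)

theorem hessian_apply (hp : 0 < p) (V W : H1Vertex N) :
    hessian N p hp V W = ∑ j, (2 * inner ℝ (compDeriv V j) (compDeriv W j) +
      2 * inner ℝ (comp V j) (comp W j) -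
      ∫ x in Ioi (0 : ℝ), inner ℝ (powFieldDeriv p (soliton p x) (comp V j x)) (comp W j x)) := by
  rw [hessian, (action_calculus hp).2.2 V W]
  refine Finset.sum_congr rfl fun j _ => ?_
  congr 1
  refine integral_congr_ae ?_
  filter_upwards [(memLp_soliton hp).coeFn_toLp] with x h
  have : comp (halfSoliton N p hp) j x = (soliton p x : ℂ) := h
  rw [this]

theorem inner_powFieldDeriv_soliton (hp : 0 < p) (x : ℝ) (z w : ℂ) :
    inner ℝ (powFieldDeriv p (soliton p x) z) w =
      (2 * p + 2) * (1 - Real.tanh (p * x) ^ 2) * ((2 * p + 1) * (z.re * w.re) + z.im * w.im) := by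
  rw [powFieldDeriv_ofReal (soliton_pos p x), soliton_rpow hp]
  simp [Complex.inner]
  ring

theorem hessian_symm (hp : 0 < p) (V W : H1Vertex N) :
    hessian N p hp V W = hessian N p hp W V := by
  rw [hessian_apply, hessian_apply]
  refine Finset.sum_congr rfl fun j _ => ?_
  rw [real_inner_comm, real_inner_comm (comp V j)]
  congr 2
  ext x
  rw [inner_powFieldDeriv_soliton hp, inner_powFieldDeriv_soliton hp]
  ring

/-- The second variation splits into the forms of the real and imaginary parts. -/
theorem hessian_self_eq (hp : 0 < p) (V : H1Vertex N) {v w : Fin N → ℝ → ℝ}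
    (hv : ∀ j, IsH1 (v j) fun x => (compDeriv V j x).re)
    (hv' : ∀ j, (fun x => (comp V j x).re) =ᵐ[edgeMeasure] v j)
    (hw : ∀ j, IsH1 (w j) fun x => (compDeriv V j x).im)
    (hw' : ∀ j, (fun x => (comp V j x).im) =ᵐ[edgeMeasure] w j) :
    hessian N p hp V V =
      2 * (∑ j, schrodingerForm (realPotential p) (v j) (fun x => (compDeriv V j x).re)) +
      2 * ∑ j, schrodingerForm (imagPotential p) (w j) (fun x => (compDeriv V j x).im) := by
  rw [hessian_apply, Finset.mul_sum, Finset.mul_sum, ← Finset.sum_add_distrib]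
  refine Finset.sum_congr rfl fun j _ => ?_
  have i1 := (hv j).integrableOn_form (continuous_realPotential p) (abs_realPotential_le hp)
  have i2 := (hw j).integrableOn_form (continuous_imagPotential p) (abs_imagPotential_le hp)
  have i3 := IsC1Field.integrable_norm_sq (compDeriv V j)
  have i4 := IsC1Field.integrable_norm_sq (comp V j)
  have i34 : Integrable (fun x => 2 * ‖compDeriv V j x‖ ^ 2 + 2 * ‖comp V j x‖ ^ 2) edgeMeasure :=
    (i3.const_mul 2).add (i4.const_mul 2)
  -- The nonlinear integrand is written as kinetic plus mass density minus the two form densities,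
  -- each already known to be integrable.
  have hpt : (fun x => inner ℝ (powFieldDeriv p (soliton p x) (comp V j x)) (comp V j x))
      =ᵐ[edgeMeasure] fun x => (2 * ‖compDeriv V j x‖ ^ 2 + 2 * ‖comp V j x‖ ^ 2) -
        (2 * ((compDeriv V j x).re ^ 2 + realPotential p x * v j x ^ 2) +
          2 * ((compDeriv V j x).im ^ 2 + imagPotential p x * w j x ^ 2)) := by
    filter_upwards [hv' j, hw' j] with x h1 h2
    rw [inner_powFieldDeriv_soliton hp, ← h1, ← h2, Complex.sq_norm, Complex.normSq_apply,
      Complex.sq_norm, Complex.normSq_apply]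
    unfold realPotential imagPotential
    ring
  have i12 : Integrable (fun x => 2 * ((compDeriv V j x).re ^ 2 + realPotential p x * v j x ^ 2) +
      2 * ((compDeriv V j x).im ^ 2 + imagPotential p x * w j x ^ 2)) edgeMeasure :=
    (i1.const_mul 2).add (i2.const_mul 2)
  rw [integral_congr_ae hpt, integral_sub i34 i12, integral_add (i3.const_mul 2) (i4.const_mul 2),
    integral_add (i1.const_mul 2) (i2.const_mul 2), integral_const_mul, integral_const_mul,
    integral_const_mul, integral_const_mul, IsC1Field.integral_norm_sq, IsC1Field.integral_norm_sq,
    real_inner_self_eq_norm_sq, real_inner_self_eq_norm_sq]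
  unfold schrodingerForm
  ring

end GraphCalculus

/-! ### Independence of representatives. -/

theorem IsH1.congr_deriv {v g h : ℝ → ℝ} (hv : IsH1 v g) (hgh : g =ᵐ[edgeMeasure] h) :
    IsH1 v h := by
  refine ⟨hv.memLp, hv.memLp_deriv.ae_eq hgh, fun b hb => ⟨(hv.hasACDeriv b hb).ac, ?_⟩⟩
  rw [Filter.EventuallyEq, ae_restrict_iff' measurableSet_Ioi] at hgh
  have h0 : ∀ᵐ x : ℝ, x ≠ 0 := by simp [ae_iff, measure_singleton]
  filter_upwards [(hv.hasACDeriv b hb).hasDerivAt, hgh, h0] with x h1 h2 h3 hm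
  rw [← h2 ?_]
  · exact h1 hm
  · rw [uIcc_of_le hb] at hm
    exact lt_of_le_of_ne hm.1 h3.symm

theorem schrodingerForm_congr {V v w g h : ℝ → ℝ} (hvw : v =ᵐ[edgeMeasure] w)
    (hgh : g =ᵐ[edgeMeasure] h) : schrodingerForm V v g = schrodingerForm V w h := by
  refine integral_congr_ae ?_
  filter_upwards [hvw, hgh] with x h1 h2
  rw [h1, h2]

theorem schrodingerForm_const_mul (V v g : ℝ → ℝ) (c : ℝ) :
    schrodingerForm V (fun x => c * v x) (fun x => c * g x) = c ^ 2 * schrodingerForm V v g := by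
  unfold schrodingerForm
  rw [← integral_const_mul]
  congr 1; ext x; ring

/-- Functions continuous up to the vertex that agree almost everywhere agree at the vertex. -/
theorem eq_at_zero_of_ae_eq {v w : ℝ → ℝ} (hv : ContinuousOn v (Ici 0))
    (hw : ContinuousOn w (Ici 0)) (h : v =ᵐ[edgeMeasure] w) : v 0 = w 0 := by
  have hI := Measure.eqOn_open_of_ae_eq h isOpen_Ioi (hv.mono Ioi_subset_Ici_self)
    (hw.mono Ioi_subset_Ici_self)
  exact hI.of_subset_closure hv hw Ioi_subset_Ici_self (by rw [closure_Ioi]) self_mem_Ici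

/-- An element of `H¹(ℝ⁺)` is determined by its function component. -/
theorem H1.ext_fst {u w : H1} (h : u.1.fst = w.1.fst) : u = w := by
  suffices hz : ∀ z : H1, z.1.fst = 0 → z = 0 by
    exact sub_eq_zero.1 (hz (u - w) (by simp [h]))
  intro z hz
  -- The weak derivative of the zero function pairs to zero with every test function.
  have hs : z.1.snd = 0 := by
    have hL : LocallyIntegrableOn (z.1.snd : ℝ → ℂ) (Ioi 0) volume :=
      locallyIntegrableOn_of_locallyIntegrable_restrict
        ((Lp.memLp z.1.snd).locallyIntegrable (by norm_num))
    have key := isOpen_Ioi.ae_eq_zero_of_integral_contDiff_smul_eq_zero hL fun η h1 h2 h3 => by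
      have h := z.2 η h1 h2 h3
      have h0 : ∫ x in Ioi (0 : ℝ), deriv η x • z.1.fst x = 0 := by
        rw [hz, ← integral_zero ℝ ℂ (μ := edgeMeasure)]
        refine integral_congr_ae ?_
        filter_upwards [Lp.coeFn_zero ℂ 2 edgeMeasure] with x hx
        rw [hx, Pi.zero_apply, smul_zero]
      rw [h0, zero_eq_neg] at h
      rw [← h, setIntegral_eq_integral_of_forall_compl_eq_zero]
      intro x hx
      rw [image_eq_zero_of_notMem_tsupport fun h => hx (h3 h), zero_smul]
    apply Lp.ext
    have h' : ∀ᵐ x ∂edgeMeasure, z.1.snd x = 0 := by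
      rwa [ae_restrict_iff' measurableSet_Ioi]
    filter_upwards [h', Lp.coeFn_zero ℂ 2 edgeMeasure] with x h1 h2
    rw [h1, h2, Pi.zero_apply]
  exact Subtype.ext ((WithLp.ofLp_injective 2) (Prod.ext hz hs))

/-! ### Nonnegativity of the second variation under the constraint. -/

section Components

variable {N : ℕ} {p : ℝ}

/-- The real and imaginary parts of an element of `H¹_Γ`, continuous up to the vertex. -/
theorem exists_components (V : H1Vertex N) : ∃ (v w : Fin N → ℝ → ℝ) (a : ℂ),
    (∀ j, IsH1 (v j) fun x => (compDeriv V j x).re) ∧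
    (∀ j, (fun x => (comp V j x).re) =ᵐ[edgeMeasure] v j) ∧
    (∀ j, IsH1 (w j) fun x => (compDeriv V j x).im) ∧
    (∀ j, (fun x => (comp V j x).im) =ᵐ[edgeMeasure] w j) ∧
    (∀ j, v j 0 = a.re) ∧ ∀ j, w j 0 = a.im := by
  choose v hv hv' using fun j => exists_isH1_re (V.1 j)
  choose w hw hw' using fun j => exists_isH1_im (V.1 j)
  obtain ⟨a, ha⟩ := V.2
  refine ⟨v, w, a, hv, hv', hw, hw', fun j => ?_, fun j => ?_⟩
  · obtain ⟨u, hu, hfu, rfl⟩ := ha j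
    refine eq_at_zero_of_ae_eq (w := fun x => (u x).re) (hv j).continuousOn
      (Complex.continuous_re.comp_continuousOn hu) ?_
    filter_upwards [hv' j, hfu] with x h1 h2
    rw [← h1, h2]
  · obtain ⟨u, hu, hfu, rfl⟩ := ha j
    refine eq_at_zero_of_ae_eq (w := fun x => (u x).im) (hw j).continuousOn
      (Complex.continuous_im.comp_continuousOn hu) ?_
    filter_upwards [hw' j, hfu] with x h1 h2
    rw [← h1, h2]

theorem inner_soliton (hp : 0 < p) (f : L2) {v w : ℝ → ℝ}
    (hv : (fun x => (f x).re) =ᵐ[edgeMeasure] v) (hw : (fun x => (f x).im) =ᵐ[edgeMeasure] w) :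
    inner ℂ ((memLp_soliton hp).toLp _ : L2) f =
      ⟨∫ x in Ioi (0 : ℝ), v x * soliton p x, ∫ x in Ioi (0 : ℝ), w x * soliton p x⟩ := by
  have hi := L2.integrable_inner (𝕜 := ℂ) ((memLp_soliton hp).toLp _ : L2) f
  rw [L2.inner_def]
  apply Complex.ext
  · rw [← Complex.reCLM_apply, ← ContinuousLinearMap.integral_comp_comm _ hi]
    refine integral_congr_ae ?_
    filter_upwards [(memLp_soliton hp).coeFn_toLp, hv] with x h1 h2
    rw [h1, ← h2]
    simp [mul_comm]
  · rw [← Complex.imCLM_apply, ← ContinuousLinearMap.integral_comp_comm _ hi]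
    refine integral_congr_ae ?_
    filter_upwards [(memLp_soliton hp).coeFn_toLp, hw] with x h1 h2
    rw [h1, ← h2]
    simp [mul_comm]

/-- Since $\varphi$ is real, the complex constraint is one real constraint on the real parts and one
on the imaginary parts. -/
theorem mem_constrained_iff (hp : 0 < p) (V : H1Vertex N) {v w : Fin N → ℝ → ℝ}
    (hv : ∀ j, (fun x => (comp V j x).re) =ᵐ[edgeMeasure] v j)
    (hw : ∀ j, (fun x => (comp V j x).im) =ᵐ[edgeMeasure] w j) :
    V ∈ constrained N p hp ↔ (∑ j, ∫ x in Ioi (0 : ℝ), v j x * soliton p x = 0) ∧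
      ∑ j, ∫ x in Ioi (0 : ℝ), w j x * soliton p x = 0 := by
  have e : l2Inner V (halfSoliton N p hp) =
      ⟨∑ j, ∫ x in Ioi (0 : ℝ), v j x * soliton p x,
        ∑ j, ∫ x in Ioi (0 : ℝ), w j x * soliton p x⟩ := by
    have : ∀ j, inner ℂ (comp (halfSoliton N p hp) j) (comp V j) =
        (⟨∫ x in Ioi (0 : ℝ), v j x * soliton p x, ∫ x in Ioi (0 : ℝ), w j x * soliton p x⟩ : ℂ) :=
      fun j => inner_soliton hp (comp V j) (hv j) (hw j)
    simp only [l2Inner, this]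
    apply Complex.ext <;> simp
  change l2Inner V (halfSoliton N p hp) = 0 ↔ _
  rw [e, Complex.ext_iff]
  rfl

/-- The second variation is nonnegative on the constrained space, and its null vectors have the
form `φ' c` with `c` real. -/
theorem hessian_nonneg (hp : 0 < p) (hp2 : p < 2) [NeZero N] {V : H1Vertex N}
    (hV : V ∈ constrained N p hp) :
    0 ≤ hessian N p hp V V ∧ (hessian N p hp V V = 0 → ∃ c : Fin N → ℝ,
      ∀ j, comp V j =ᵐ[edgeMeasure] fun x => ((c j * deriv (soliton p) x : ℝ) : ℂ)) := by
  obtain ⟨v, w, a, hv, hv', hw, hw', ha, ha'⟩ := exists_components V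
  obtain ⟨o1, o2⟩ := (mem_constrained_iff hp V hv' hw').1 hV
  obtain ⟨n1, z1⟩ := sum_realForm_nonneg hp hp2 hv ha o1
  have n2 : 0 ≤ ∑ j, schrodingerForm (imagPotential p) (w j) (fun x => (compDeriv V j x).im) :=
    Finset.sum_nonneg fun j _ => (imagForm_nonneg hp (hw j)).1
  rw [hessian_self_eq hp V hv hv' hw hw']
  refine ⟨by positivity, fun hz => ?_⟩
  -- Both summands are nonnegative, so a vanishing total makes each of them vanish.
  obtain ⟨c, hc⟩ := z1 (by linarith)
  have hwz := sum_imagForm_eq_zero hp hw ha' o2 (by linarith)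
  refine ⟨c, fun j => ?_⟩
  filter_upwards [hv' j, hw' j, ae_restrict_mem measurableSet_Ioi] with x h1 h2 hx
  apply Complex.ext
  · rw [h1, hc j x hx, Complex.ofReal_re]
  · rw [h2, hwz j x hx, Complex.ofReal_im]

end Components

/-! ### The null states $\varphi'c$. -/

section DerivState

variable {N : ℕ} {p : ℝ}

theorem memLp_deriv2_soliton (hp : 0 < p) :
    MemLp (fun x => ((soliton p x * (Real.tanh (p * x) ^ 2 - p * (1 - Real.tanh (p * x) ^ 2)) : ℝ)
      : ℂ)) 2 edgeMeasure :=
  (isH1_deriv_soliton hp).memLp_deriv.ofReal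

/-- The pair `(φ', φ'')` as an element of `H¹(ℝ⁺)`. -/
def derivSolitonH1 (p : ℝ) (hp : 0 < p) : H1 :=
  ⟨WithLp.toLp 2 ((memLp_deriv_soliton hp).toLp _, (memLp_deriv2_soliton hp).toLp _), by
    intro η h1 h2 h3
    change ∫ x in Ioi (0 : ℝ), deriv η x • ((memLp_deriv_soliton hp).toLp _ : ℝ → ℂ) x =
      -∫ x in Ioi (0 : ℝ), η x • ((memLp_deriv2_soliton hp).toLp _ : ℝ → ℂ) x
    have hη' : Continuous (deriv η) := h1.continuous_deriv (by simp)
    have hη : IsH1 η (deriv η) := .of_hasDerivAt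
      (fun x => (h1.differentiable (by simp) x).hasDerivAt) hη'
      ((h1.continuous.memLp_of_hasCompactSupport h2).restrict _)
      ((hη'.memLp_of_hasCompactSupport h2.deriv).restrict _)
    have hd := isH1_deriv_soliton hp
    have key := hη.integral_deriv_mul_add hd
    rw [image_eq_zero_of_notMem_tsupport fun h => lt_irrefl (0 : ℝ) (h3 h), zero_mul, neg_zero,
      integral_add (IsH1.integrableOn_mul hη.memLp_deriv hd.memLp)
        (IsH1.integrableOn_mul hη.memLp hd.memLp_deriv)] at key
    have e1 : ∫ x in Ioi (0 : ℝ), deriv η x • ((memLp_deriv_soliton hp).toLp _ : ℝ → ℂ) x =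
        ((∫ x in Ioi (0 : ℝ), deriv η x * deriv (soliton p) x : ℝ) : ℂ) := by
      rw [← integral_complex_ofReal]
      refine integral_congr_ae ?_
      filter_upwards [(memLp_deriv_soliton hp).coeFn_toLp] with x hx
      rw [hx, Complex.real_smul, Complex.ofReal_mul]
    have e2 : ∫ x in Ioi (0 : ℝ), η x • ((memLp_deriv2_soliton hp).toLp _ : ℝ → ℂ) x =
        ((∫ x in Ioi (0 : ℝ), η x * (soliton p x *
          (Real.tanh (p * x) ^ 2 - p * (1 - Real.tanh (p * x) ^ 2))) : ℝ) : ℂ) := by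
      rw [← integral_complex_ofReal]
      refine integral_congr_ae ?_
      filter_upwards [(memLp_deriv2_soliton hp).coeFn_toLp] with x hx
      rw [hx, Complex.real_smul, ← Complex.ofReal_mul]
    rw [e1, e2, eq_neg_iff_add_eq_zero, ← Complex.ofReal_add, key, Complex.ofReal_zero]⟩

/-- The states `φ' c`, with `c ∈ ℝ^N`. -/
def derivState (N : ℕ) (p : ℝ) (hp : 0 < p) : (Fin N → ℝ) →ₗ[ℝ] H1Vertex N where
  -- Because $\varphi'(0)=0$, the vertex condition holds with common value $0$ for every $c$.
  toFun c := ⟨WithLp.toLp 2 fun k => c k • derivSolitonH1 p hp, 0, fun k =>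
    ⟨fun x => c k • ((deriv (soliton p) x : ℝ) : ℂ), by
      have := continuous_deriv_soliton hp
      exact Continuous.continuousOn (by fun_prop), by
      have h1 := Lp.coeFn_smul (c k) ((memLp_deriv_soliton hp).toLp _ : L2)
      filter_upwards [h1, (memLp_deriv_soliton hp).coeFn_toLp] with x h2 h3
      change (c k • ((memLp_deriv_soliton hp).toLp _ : L2) : L2) x = _
      rw [h2, Pi.smul_apply, h3], by simp [deriv_soliton hp]⟩⟩
  map_add' c d := Subtype.ext (PiLp.ext fun k => add_smul (c k) (d k) (derivSolitonH1 p hp))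
  map_smul' r c := Subtype.ext (PiLp.ext fun k => mul_smul r (c k) (derivSolitonH1 p hp))

theorem comp_derivState (hp : 0 < p) (c : Fin N → ℝ) (k : Fin N) :
    comp (derivState N p hp c) k = c k • ((memLp_deriv_soliton hp).toLp _ : L2) := rfl

theorem compDeriv_derivState (hp : 0 < p) (c : Fin N → ℝ) (k : Fin N) :
    compDeriv (derivState N p hp c) k = c k • ((memLp_deriv2_soliton hp).toLp _ : L2) := rfl

theorem comp_derivState_ae (hp : 0 < p) (c : Fin N → ℝ) (k : Fin N) :
    comp (derivState N p hp c) k =ᵐ[edgeMeasure]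
      fun x => ((c k * deriv (soliton p) x : ℝ) : ℂ) := by
  rw [comp_derivState]
  filter_upwards [Lp.coeFn_smul (c k) ((memLp_deriv_soliton hp).toLp _ : L2),
    (memLp_deriv_soliton hp).coeFn_toLp] with x h1 h2
  rw [h1, Pi.smul_apply, h2, Complex.real_smul, Complex.ofReal_mul]

theorem compDeriv_derivState_ae (hp : 0 < p) (c : Fin N → ℝ) (k : Fin N) :
    compDeriv (derivState N p hp c) k =ᵐ[edgeMeasure] fun x => ((c k * (soliton p x *
      (Real.tanh (p * x) ^ 2 - p * (1 - Real.tanh (p * x) ^ 2))) : ℝ) : ℂ) := by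
  rw [compDeriv_derivState]
  filter_upwards [Lp.coeFn_smul (c k) ((memLp_deriv2_soliton hp).toLp _ : L2),
    (memLp_deriv2_soliton hp).coeFn_toLp] with x h1 h2
  rw [h1, Pi.smul_apply, h2, Complex.real_smul, ← Complex.ofReal_mul]

/-- Null vectors are identified only as functions; their weak derivatives then agree by
`H1.ext_fst`. -/
theorem eq_derivState_of_comp_ae (hp : 0 < p) {V : H1Vertex N} {c : Fin N → ℝ}
    (h : ∀ j, comp V j =ᵐ[edgeMeasure] fun x => ((c j * deriv (soliton p) x : ℝ) : ℂ)) :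
    V = derivState N p hp c :=
  Subtype.ext (PiLp.ext fun k => H1.ext_fst (Lp.ext ((h k).trans (comp_derivState_ae hp c k).symm)))

theorem derivState_mem_constrained_iff (hp : 0 < p) (c : Fin N → ℝ) :
    derivState N p hp c ∈ constrained N p hp ↔ ∑ k, c k = 0 := by
  rw [mem_constrained_iff hp (derivState N p hp c) (v := fun k x => c k * deriv (soliton p) x)
    (w := fun _ _ => 0)]
  · have e : ∀ k, ∫ x in Ioi (0 : ℝ), c k * deriv (soliton p) x * soliton p x =
        c k * -(1 / 2) := fun k => by
      rw [← integral_soliton_mul_deriv hp, ← integral_const_mul]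
      congr 1; ext x; ring
    simp only [e, zero_mul, integral_zero, Finset.sum_const_zero, and_true, ← Finset.sum_mul]
    simp
  · intro k
    filter_upwards [comp_derivState_ae hp c k] with x hx
    rw [hx, Complex.ofReal_re]
  · intro k
    filter_upwards [comp_derivState_ae hp c k] with x hx
    rw [hx, Complex.ofReal_im]

theorem hessian_derivState (hp : 0 < p) (c : Fin N → ℝ) :
    hessian N p hp (derivState N p hp c) (derivState N p hp c) = 0 := by
  have r1 : ∀ k, (fun x => (compDeriv (derivState N p hp c) k x).re) =ᵐ[edgeMeasure]
      fun x => c k * (soliton p x *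
        (Real.tanh (p * x) ^ 2 - p * (1 - Real.tanh (p * x) ^ 2))) := fun k => by
    filter_upwards [compDeriv_derivState_ae hp c k] with x hx
    rw [hx, Complex.ofReal_re]
  have r2 : ∀ k, (fun x => (compDeriv (derivState N p hp c) k x).im) =ᵐ[edgeMeasure]
      fun _ => 0 := fun k => by
    filter_upwards [compDeriv_derivState_ae hp c k] with x hx
    rw [hx, Complex.ofReal_im]
  have h0 : IsH1 (fun _ => 0) (fun _ => 0) := by
    simpa using (isH1_soliton hp).const_mul 0
  rw [hessian_self_eq hp (derivState N p hp c) (v := fun k x => c k * deriv (soliton p) x)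
    (w := fun _ _ => 0) (fun k => ((isH1_deriv_soliton hp).const_mul (c k)).congr_deriv (r1 k).symm)
    (fun k => ?_) (fun k => h0.congr_deriv (r2 k).symm) (fun k => ?_)]
  · have e1 : ∀ k, schrodingerForm (realPotential p) (fun x => c k * deriv (soliton p) x)
        (fun x => (compDeriv (derivState N p hp c) k x).re) = 0 := fun k => by
      rw [schrodingerForm_congr Filter.EventuallyEq.rfl (r1 k), schrodingerForm_const_mul,
        realForm_deriv_soliton hp, mul_zero]
    have e2 : ∀ k, schrodingerForm (imagPotential p) (fun _ => 0)
        (fun x => (compDeriv (derivState N p hp c) k x).im) = 0 := fun k => by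
      rw [schrodingerForm_congr Filter.EventuallyEq.rfl (r2 k)]
      simp [schrodingerForm]
    simp [e1, e2]
  · filter_upwards [comp_derivState_ae hp c k] with x hx
    rw [hx, Complex.ofReal_re]
  · filter_upwards [comp_derivState_ae hp c k] with x hx
    rw [hx, Complex.ofReal_im]

theorem hessian_zero_zero (hp : 0 < p) : hessian N p hp 0 0 = 0 := by
  have h := hessian_derivState hp (0 : Fin N → ℝ)
  rwa [(derivState N p hp).map_zero] at h

theorem l2Inner_derivState (hp : 0 < p) (c d : Fin N → ℝ) :
    l2Inner (derivState N p hp c) (derivState N p hp d) =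
      ((∑ k, c k * d k : ℝ) : ℂ) *
        inner ℂ ((memLp_deriv_soliton hp).toLp _ : L2) ((memLp_deriv_soliton hp).toLp _ : L2) := by
  have e : ∀ (r : ℝ) (f : L2), r • f = (r : ℂ) • f := fun r f => (algebraMap_smul ℂ r f).symm
  simp only [l2Inner, comp_derivState, e, inner_smul_left, inner_smul_right, Complex.conj_ofReal]
  push_cast
  rw [Finset.sum_mul]
  refine Finset.sum_congr rfl fun k _ => ?_
  ring

/-- Pairing the $k$-th component with $\varphi$ gives $-c_k/2$. -/
theorem derivState_injective (hp : 0 < p) : Function.Injective (derivState N p hp) := by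
  rw [← LinearMap.ker_eq_bot, LinearMap.ker_eq_bot']
  intro c hc
  funext k
  have h1 : comp (derivState N p hp c) k = 0 := by rw [hc]; rfl
  have h2 := inner_soliton hp (comp (derivState N p hp c) k)
    (v := fun x => c k * deriv (soliton p) x) (w := fun _ => 0)
    (by
      filter_upwards [comp_derivState_ae hp c k] with x hx
      rw [hx, Complex.ofReal_re])
    (by
      filter_upwards [comp_derivState_ae hp c k] with x hx
      rw [hx, Complex.ofReal_im])
  rw [h1, inner_zero_right] at h2
  have h3 := congrArg Complex.re h2
  have e : ∫ x in Ioi (0 : ℝ), c k * deriv (soliton p) x * soliton p x = c k * -(1 / 2) := by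
    rw [← integral_soliton_mul_deriv hp, ← integral_const_mul]
    congr 1; ext x; ring
  simp only [Complex.zero_re, e] at h3
  simp only [Pi.zero_apply]
  linarith

end DerivState

/-! ### The vectors $e_j$ as an orthogonal basis of $\{\sum c_k=0\}$. -/

section DirVec

variable {N : ℕ}

theorem sum_dirVec (j : Fin (N - 1)) : ∑ k, dirVec N j k = 0 := by
  have hj := j.2
  -- Indices start at zero: there are $j+1$ leading ones, balanced by the entry $-(j+1)$ at position
  -- $j+1$.
  let f : ℕ → ℝ := fun k => (if k ∈ Finset.range (j.val + 1) then 1 else 0) -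
    (if k = j.val + 1 then (j.val : ℝ) + 1 else 0)
  have e : ∀ k : Fin N, dirVec N j k = f k := by
    intro k
    simp only [f, dirVec, Finset.mem_range]
    split_ifs <;> first | omega | simp
  rw [Finset.sum_congr rfl fun k _ => e k, Fin.sum_univ_eq_sum_range f N, Finset.sum_sub_distrib,
    Finset.sum_ite_mem, Finset.sum_ite_eq',
    Finset.inter_eq_right.2 (Finset.range_subset_range.2 (by omega)),
    if_pos (Finset.mem_range.2 (by omega))]
  simp

/-- For $i<j$ the later vector equals $1$ on the support of the earlier one, so the product sums to
the coordinate sum of the earlier one. -/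
theorem sum_dirVec_mul_of_lt {i j : Fin (N - 1)} (h : i < j) :
    ∑ k, dirVec N i k * dirVec N j k = 0 := by
  rw [← sum_dirVec i]
  refine Finset.sum_congr rfl fun k _ => ?_
  have h' : i.val < j.val := h
  simp only [dirVec]
  split_ifs <;> first | omega | simp

theorem sum_dirVec_mul {i j : Fin (N - 1)} (h : i ≠ j) :
    ∑ k, dirVec N i k * dirVec N j k = 0 := by
  rcases lt_or_gt_of_ne h with h | h
  · exact sum_dirVec_mul_of_lt h
  · rw [← sum_dirVec_mul_of_lt h]
    exact Finset.sum_congr rfl fun k _ => mul_comm _ _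

theorem sum_dirVec_sq_pos (j : Fin (N - 1)) : 0 < ∑ k, dirVec N j k * dirVec N j k := by
  have hj := j.2
  refine Finset.sum_pos' (fun k _ => mul_self_nonneg _) ⟨⟨0, by omega⟩, Finset.mem_univ _, ?_⟩
  simp [dirVec]

theorem linearIndependent_dirVec : LinearIndependent ℝ (dirVec N) := by
  rw [Fintype.linearIndependent_iff]
  intro a ha j
  have h : ∑ k, (∑ i, a i • dirVec N i) k * dirVec N j k = 0 := by rw [ha]; simp
  simp only [Finset.sum_apply, Pi.smul_apply, smul_eq_mul, Finset.sum_mul] at h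
  rw [Finset.sum_comm, Finset.sum_eq_single j] at h
  · simp only [mul_assoc, ← Finset.mul_sum] at h
    exact (mul_eq_zero.1 h).resolve_right (sum_dirVec_sq_pos j).ne'
  · intro i _ hij
    simp only [mul_assoc, ← Finset.mul_sum, sum_dirVec_mul hij, mul_zero]
  · simp

/-- Inclusion in the hyperplane and equality of dimensions: $N-1$ independent vectors in the kernel
of a nonzero functional on $\mathbb R^N$. -/
theorem span_dirVec [NeZero N] (c : Fin N → ℝ) :
    c ∈ Submodule.span ℝ (range (dirVec N)) ↔ ∑ k, c k = 0 := by
  let σ : (Fin N → ℝ) →ₗ[ℝ] ℝ := ∑ k, LinearMap.proj k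
  have hσ : ∀ c, σ c = ∑ k, c k := fun c => by simp [σ]
  have hle : Submodule.span ℝ (range (dirVec N)) ≤ LinearMap.ker σ := by
    rw [Submodule.span_le]
    rintro _ ⟨j, rfl⟩
    exact (hσ _).trans (sum_dirVec j)
  have hr : LinearMap.range σ = ⊤ := by
    rw [LinearMap.range_eq_top]
    intro t
    exact ⟨Pi.single 0 t, by rw [hσ, Finset.sum_pi_single']; simp⟩
  have hrank := LinearMap.finrank_range_add_finrank_ker σ
  rw [hr, finrank_top, Module.finrank_self, Module.finrank_fin_fun] at hrank
  have heq : Submodule.span ℝ (range (dirVec N)) = LinearMap.ker σ := by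
    refine Submodule.eq_of_le_of_finrank_eq hle ?_
    rw [finrank_span_eq_card linearIndependent_dirVec, Fintype.card_fin]
    omega
  rw [heq, LinearMap.mem_ker, hσ]

end DirVec

/-! ### Null vectors lie in the kernel of the form, and the theorem. -/

theorem continuousLinearMap_bilin_add_smul {X : Type*} [AddCommGroup X] [Module ℝ X]
    [TopologicalSpace X] (H : X →L[ℝ] X →L[ℝ] ℝ) {V W : X} (hs : H W V = H V W) (t : ℝ) :
    H (V + t • W) (V + t • W) = H V V + 2 * t * H V W + t ^ 2 * H W W := by
  simp only [map_add, map_smul, add_apply, smul_apply, smul_eq_mul, hs]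
  ring

/-- A null vector of a nonnegative symmetric form on a subspace is in its kernel. -/
theorem hessian_eq_zero_of_null {N : ℕ} {p : ℝ} (hp : 0 < p)
    (hn : ∀ V ∈ constrained N p hp, 0 ≤ hessian N p hp V V) {V W : H1Vertex N}
    (hV : V ∈ constrained N p hp) (hz : hessian N p hp V V = 0) (hW : W ∈ constrained N p hp) :
    hessian N p hp V W = 0 := by
  have key : ∀ t : ℝ, 0 ≤ 2 * t * hessian N p hp V W + t ^ 2 * hessian N p hp W W := by
    intro t
    have hm : V + t • W ∈ constrained N p hp := by
      refine Submodule.add_mem _ hV ?_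
      rw [← algebraMap_smul ℂ t W]
      exact Submodule.smul_mem _ _ hW
    have h := hn _ hm
    rw [continuousLinearMap_bilin_add_smul _ (hessian_symm hp W V), hz] at h
    linarith
  by_contra hne
  have hWW := hn W hW
  set A := hessian N p hp V W
  set B := hessian N p hp W W
  -- The optimal $t$ would be $-A/B$; the denominator $B+1$ stays positive when $B=0$ and still
  -- makes the quadratic negative.
  have h1 := key (-A / (B + 1))
  have hB : 0 < B + 1 := by linarith
  have e : 2 * (-A / (B + 1)) * A + (-A / (B + 1)) ^ 2 * B =
      -(A ^ 2 * (B + 2)) / (B + 1) ^ 2 := by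
    field_simp
    ring
  rw [e] at h1
  have hA : 0 < A ^ 2 := by positivity
  have : -(A ^ 2 * (B + 2)) / (B + 1) ^ 2 < 0 :=
    div_neg_of_neg_of_pos (by nlinarith) (by positivity)
  linarith

end StarGraph

end

theorem theorem1 (N : ℕ) (hN : 3 ≤ N) (p : ℝ) (hp : 0 < p) (hp2 : p < 2) :
    -- the second variation exists in the sense of Fréchet
    (∀ᶠ Ψ in 𝓝 (StarGraph.halfSoliton N p hp), DifferentiableAt ℝ (StarGraph.action N p) Ψ) ∧
    DifferentiableAt ℝ (fderiv ℝ (StarGraph.action N p)) (StarGraph.halfSoliton N p hp) ∧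
    -- it is nonnegative under the constraint
    (∀ V ∈ StarGraph.constrained N p hp, 0 ≤ StarGraph.hessian N p hp V V) ∧
    -- its null set under the constraint
    (∃ U : Fin (N - 1) → StarGraph.H1Vertex N,
      (∀ j k, StarGraph.comp (U j) k =ᵐ[StarGraph.edgeMeasure]
        fun x => ((deriv (StarGraph.soliton p) x * StarGraph.dirVec N j k : ℝ) : ℂ)) ∧
      (Pairwise fun i j => StarGraph.l2Inner (U i) (U j) = 0) ∧
      Module.finrank ℝ (Submodule.span ℝ (Set.range U)) = N - 1 ∧
      ∀ V, (V ∈ StarGraph.constrained N p hp ∧ StarGraph.hessian N p hp V V = 0) ↔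
        V ∈ Submodule.span ℝ (Set.range U)) ∧
    -- zero is a degenerate minimizer
    IsMinOn (fun V => StarGraph.hessian N p hp V V) (StarGraph.constrained N p hp) 0 ∧
    (∃ V ∈ StarGraph.constrained N p hp, V ≠ 0 ∧
      ∀ W ∈ StarGraph.constrained N p hp, StarGraph.hessian N p hp V W = 0) := by
  have : NeZero N := ⟨by omega⟩
  obtain ⟨d1, d2, -⟩ := StarGraph.action_calculus (N := N) hp
  have hn : ∀ V ∈ StarGraph.constrained N p hp, 0 ≤ StarGraph.hessian N p hp V V :=
    fun V hV => (StarGraph.hessian_nonneg hp hp2 hV).1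
  set S := StarGraph.derivState N p hp
  have hinj : Function.Injective S := StarGraph.derivState_injective hp
  have hspan : Submodule.span ℝ (Set.range fun j => S (StarGraph.dirVec N j)) =
      (Submodule.span ℝ (Set.range (StarGraph.dirVec N))).map S := by
    rw [Submodule.map_span, ← Set.range_comp]
    rfl
  refine ⟨Filter.Eventually.of_forall d1, d2, hn, ⟨fun j => S (StarGraph.dirVec N j),
    fun j k => ?_, fun i j hij => ?_, ?_, fun V => ?_⟩, fun V hV => ?_, ?_⟩
  · filter_upwards [StarGraph.comp_derivState_ae hp (StarGraph.dirVec N j) k] with x hx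
    rw [hx, mul_comm]
  · change StarGraph.l2Inner (S (StarGraph.dirVec N i)) (S (StarGraph.dirVec N j)) = 0
    rw [StarGraph.l2Inner_derivState, StarGraph.sum_dirVec_mul hij, Complex.ofReal_zero, zero_mul]
  · exact (finrank_span_eq_card (StarGraph.linearIndependent_dirVec.map' _
      (LinearMap.ker_eq_bot.2 hinj))).trans (Fintype.card_fin _)
  · rw [hspan, Submodule.mem_map]
    constructor
    · rintro ⟨hV, hz⟩
      obtain ⟨c, hc⟩ := (StarGraph.hessian_nonneg hp hp2 hV).2 hz
      -- Once $V=\varphi'c$, the constraint says $\sum c_k=0$, which is membership of $c$ in the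
      -- span of the $e_j$.
      have e := StarGraph.eq_derivState_of_comp_ae hp hc
      rw [e, StarGraph.derivState_mem_constrained_iff] at hV
      exact ⟨c, (StarGraph.span_dirVec c).2 hV, e.symm⟩
    · rintro ⟨c, hc, rfl⟩
      exact ⟨(StarGraph.derivState_mem_constrained_iff hp c).2 ((StarGraph.span_dirVec c).1 hc),
        StarGraph.hessian_derivState hp c⟩
  · exact (StarGraph.hessian_zero_zero hp).le.trans (hn V hV)
  -- The witness is $\varphi'(1,-1,0,\dots,0)$, a constrained null vector and hence in the kernel.
  · have hj : 0 < N - 1 := by omega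
    have hm := (StarGraph.derivState_mem_constrained_iff hp _).2
      (StarGraph.sum_dirVec (N := N) ⟨0, hj⟩)
    refine ⟨S (StarGraph.dirVec N ⟨0, hj⟩), hm, fun h => ?_, fun W hW =>
      StarGraph.hessian_eq_zero_of_null hp hn hm (StarGraph.hessian_derivState hp _) hW⟩
    exact StarGraph.linearIndependent_dirVec.ne_zero _ (hinj (h.trans (map_zero _).symm))
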